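/- Let $\mathbb N=\{1,2,\dots\}$ and $[n]=\{1,\dots,n\}$. An \emph{indexed forest} is a sequence $F=(T_1,T_2,\dots)$ of binary plane trees (every node is either a leaf or an internal node with a left child $v_L$ and a right child $v_R$), all but finitely many of which are the one-node tree $\ast$. Its leaves are identified with $\mathbb N$ from left to right. Write $\emptyset$ for the forest with all trees trivial, $\operatorname{supp}(F)$ for the set of leaves of the nontrivial trees, and $\mathsf{Forest}_n=\{F : \operatorname{supp}(F)\subseteq[n]\}$. The \emph{canonical label} of an internal node $v$ is the rightmost leaf that is a descendant of (or equal to) $v_L$. A \emph{Sylvester word} of $F$ is a sequence that contains the canonical label of each internal node of $F$ exactly once, and nothing else, such that the label of each internal node precedes the labels of those of its children that are internal; $\operatorname{Sylv}(F)$ is the set of these words. Let $\operatorname{QDes}(F)$ be the set of leaves $i$ such that $i=v_L$ for a terminal node $v$ of $F$ (an internal node both of whose children are leaves), and for $i\in\operatorname{QDes}(F)$ let $F/i$ be the indexed forest obtained by deleting this terminal node, i.e. by replacing it with a leaf. For $f(\mathbf x;\mathbf t)\in\mathbb Z[\mathbf t][\mathbf x]$, where $\mathbf x=(x_1,x_2,\dots)$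 and $\mathbf t=(t_1,t_2,\dots)$, put $$\mathsf E_i f=\frac{f(x_1,\dots,x_{i-1},x_i,t_i,x_{i+1},\dots;\mathbf t)-f(x_1,\dots,x_{i-1},t_i,x_i,x_{i+1},\dots;\mathbf t)}{x_i-t_i}.$$ The \emph{double forest polynomials} $\mathfrak P_F(\mathbf x;\mathbf t)$ are the unique family of homogeneous polynomials in $\mathbb Z[\mathbf t][\mathbf x]$, indexed by all indexed forests $F$, such that $\mathfrak P_\emptyset(\mathbf t;\mathbf t)=1$, $\mathfrak P_F(\mathbf t;\mathbf t)=0$ for $F\neq\emptyset$, and, for all $i\ge1$, $\mathsf E_i\mathfrak P_F=\mathfrak P_{F/i}(\mathbf x;t_1,\dots,t_{i-1},t_{i+1},\dots)$ if $i\in\operatorname{QDes}(F)$ and $\mathsf E_i\mathfrak P_F=0$ otherwise. For a permutation $\sigma$ of $\mathbb N$ moving only finitely many elements, let $\operatorname{ev}_\sigma f=f(t_{\sigma(1)},t_{\sigma(2)},\dots;\mathbf t)\in\mathbb Z[\mathbf t]$. Regard $S_n$ as the group of permutations of $\mathbb N$ that fix every $a>n$, let $s_i=(i\;i+1)$, and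 let $\ell(\sigma)$ be the number of inversions of $\sigma\in S_n$. A set partition of $[n]$ is noncrossing if there are no two distinct blocks $A,B$ with $a,b\in A$, $c,d\in B$ and $a<c<b<d$. Let $\operatorname{NC}_n\subseteq S_n$ be the set of \emph{noncrossing permutations}: products, over the blocks $\{a_1<\dots<a_p\}$ of a noncrossing partition of $[n]$, of the cycles $(a_p\,a_{p-1}\cdots a_1)$. A \emph{noncrossing descent} of $\sigma\in\operatorname{NC}_n$ is an $i$ with $1\le i<n$, $\sigma s_i\in\operatorname{NC}_n$ and $\ell(\sigma s_i)<\ell(\sigma)$. A \emph{noncrossing reduced word} of $\sigma\in\operatorname{NC}_n$ is a word $(i_1,\dots,i_\ell)$ with $s_{i_1}\cdots s_{i_\ell}=\sigma$ such that for every $1\le k\le\ell$ the permutation $s_{i_1}\cdots s_{i_k}$ lies in $\operatorname{NC}_n$ and has $i_k$ as a noncrossing descent. \textbf{Theorem.} Let $F\in\mathsf{Forest}_n$, let $\sigma\in\operatorname{NC}_n$, let $\omega=(i_1,\dots,i_\ell)$ be any noncrossing reduced word of $\sigma$, and put $\sigma^{(p)}=s_{i_1}\cdots s_{i_p}$. Then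 $$\operatorname{ev}_\sigma(\mathfrak P_F)=\sum_{S}\ \prod_{p\in S}\bigl(t_{\sigma^{(p-1)}(i_p+1)}-t_{\sigma^{(p-1)}(i_p)}\bigr),$$ where the sum is over all sets of positions $S=\{p_1<\dots<p_m\}\subseteq\{1,\dots,\ell\}$ such that the subword $(i_{p_1},\dots,i_{p_m})$ of $\omega$ is a Sylvester word of $F$. -/

import Mathlib

/-!
All indices are shifted down by one: the positive integer `i` of the mathematical text is the
natural number `i - 1` here.  Thus the variables are `x 0, x 1, …` and `t 0, t 1, …`, leaves and
trees of a forest are numbered from `0`, `[n]` is `{0, …, n - 1}` and the simple transposition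
`s i` exchanges `i` and `i + 1` for `i = 0, 1, …`.
-/

/-! ### Indexed forests -/

/-- A binary plane tree is a `BinaryTree Unit`, where `nil` is the tree with one node (a leaf) and
`node () l r` has an internal root with left subtree `l` and right subtree `r`.  An indexed forest
is a sequence of such trees, all but finitely many of which are trivial. -/
@[ext]
structure IndexedForest where
  trees : ℕ → BinaryTree Unit
  finite_nontrivial : {k | trees k ≠ BinaryTree.nil}.Finite

/-- `SubtreeAt t a s b`: if the leaves of `t` are numbered `a, a + 1, …` from left to right, then
the subtree of descendants of some node of `t` is `s`, with its leaves numbered `b, b + 1, …`. -/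
inductive SubtreeAt (t : BinaryTree Unit) (a : ℕ) : BinaryTree Unit → ℕ → Prop
  | root : SubtreeAt t a t a
  | left {l r : BinaryTree Unit} {b : ℕ} :
      SubtreeAt t a (BinaryTree.node () l r) b → SubtreeAt t a l b
  | right {l r : BinaryTree Unit} {b : ℕ} :
      SubtreeAt t a (BinaryTree.node () l r) b → SubtreeAt t a r (b + l.numLeaves)

/-- Delete the terminal node whose left leaf has position `i` in the tree (the leaves of the tree
being numbered `0, 1, …`); the tree is unchanged if there is no such node. -/
def trimTree : ℕ → BinaryTree Unit → BinaryTree Unit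
  | _, BinaryTree.nil => BinaryTree.nil
  | i, BinaryTree.node _ BinaryTree.nil BinaryTree.nil =>
      if i = 0 then BinaryTree.nil else BinaryTree.node () BinaryTree.nil BinaryTree.nil
  | i, BinaryTree.node _ l r =>
      if i < l.numLeaves then BinaryTree.node () (trimTree i l) r
      else BinaryTree.node () l (trimTree (i - l.numLeaves) r)

namespace IndexedForest

/-- The forest all of whose trees are trivial. -/
def empty : IndexedForest where
  trees _ := BinaryTree.nil
  finite_nontrivial := by simp

/-- The number of the leftmost leaf of the `k`-th tree. -/
def firstLeaf (F : IndexedForest) (k : ℕ) : ℕ :=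
  ∑ j ∈ Finset.range k, (F.trees j).numLeaves

/-- A node of the forest whose subtree of descendants is `s` with leftmost leaf `b`. -/
def HasSubtree (F : IndexedForest) (s : BinaryTree Unit) (b : ℕ) : Prop :=
  ∃ k, SubtreeAt (F.trees k) (F.firstLeaf k) s b

/-- The leaves of the nontrivial trees. -/
def support (F : IndexedForest) : Set ℕ :=
  {j | ∃ k, F.trees k ≠ BinaryTree.nil ∧ F.firstLeaf k ≤ j ∧
    j < F.firstLeaf k + (F.trees k).numLeaves}

/-- The leftmost leaves of the terminal nodes (those whose two children are leaves). -/
def qdes (F : IndexedForest) : Set ℕ :=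
  {i | F.HasSubtree (BinaryTree.node () BinaryTree.nil BinaryTree.nil) i}

/-- `F / i`: for `i ∈ F.qdes`, delete the terminal node with leftmost leaf `i`. -/
def trim (F : IndexedForest) (i : ℕ) : IndexedForest where
  trees k := if F.firstLeaf k ≤ i ∧ i < F.firstLeaf (k + 1)
    then trimTree (i - F.firstLeaf k) (F.trees k) else F.trees k
  finite_nontrivial := by
    refine F.finite_nontrivial.subset fun k hk h => hk ?_
    simp [h, trimTree]

/-- The canonical label of an internal node with subtrees `l`, `r` and leftmost leaf `b`: the
rightmost leaf of the left subtree. -/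
def nodeLabel (l : BinaryTree Unit) (b : ℕ) : ℕ := b + l.numLeaves - 1

/-- Sylvester words: every canonical label of an internal node occurs exactly once, nothing else
occurs, and the label of an internal node precedes the labels of its internal children. -/
structure IsSylvester (F : IndexedForest) (w : List ℕ) : Prop where
  nodup : w.Nodup
  mem_iff : ∀ i, i ∈ w ↔ ∃ l r b, F.HasSubtree (BinaryTree.node () l r) b ∧ i = nodeLabel l b
  before_left : ∀ l₁ l₂ r b, F.HasSubtree (BinaryTree.node () (BinaryTree.node () l₁ l₂) r) b →
    w.idxOf (nodeLabel (BinaryTree.node () l₁ l₂) b) < w.idxOf (nodeLabel l₁ b)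
  before_right : ∀ l r₁ r₂ b, F.HasSubtree (BinaryTree.node () l (BinaryTree.node () r₁ r₂)) b →
    w.idxOf (nodeLabel l b) < w.idxOf (nodeLabel r₁ (b + l.numLeaves))

end IndexedForest

/-! ### Double forest polynomials -/

noncomputable section

/-- The ring `ℤ[t][x]`. -/
abbrev PolTX : Type := MvPolynomial (ℕ ⊕ ℕ) ℤ

/-- The ring `ℤ[t]`. -/
abbrev PolT : Type := MvPolynomial ℕ ℤ

def xVar (i : ℕ) : PolTX := MvPolynomial.X (Sum.inl i)

def tVar (i : ℕ) : PolTX := MvPolynomial.X (Sum.inr i)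

/-- `f ↦ f(x_0, …, x_{i-1}, t_i, x_i, x_{i+1}, …; t)`. -/
def bsMinus (i : ℕ) : PolTX →ₐ[ℤ] PolTX :=
  MvPolynomial.aeval (Sum.elim
    (fun j => if j < i then xVar j else if j = i then tVar i else xVar (j - 1)) tVar)

/-- `f ↦ f(x_0, …, x_{i-1}, x_i, t_i, x_{i+1}, …; t)`. -/
def bsPlus (i : ℕ) : PolTX →ₐ[ℤ] PolTX :=
  MvPolynomial.aeval (Sum.elim
    (fun j => if j ≤ i then xVar j else if j = i + 1 then tVar i else xVar (j - 1)) tVar)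

theorem dvd_bsPlus_sub_bsMinus (i : ℕ) (f : PolTX) :
    xVar i - tVar i ∣ bsPlus i f - bsMinus i f := by
  induction f using MvPolynomial.induction_on with
  | C a => simp [bsPlus, bsMinus]
  | add p q hp hq =>
    have h : bsPlus i (p + q) - bsMinus i (p + q)
        = (bsPlus i p - bsMinus i p) + (bsPlus i q - bsMinus i q) := by
      simp only [map_add]; ring
    rw [h]
    exact dvd_add hp hq
  | mul_X p v hp =>
    have hv : xVar i - tVar i ∣
        bsPlus i (MvPolynomial.X v) - bsMinus i (MvPolynomial.X v) := by
      rcases v with j | j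
      · simp only [bsPlus, bsMinus, MvPolynomial.aeval_X, Sum.elim_inl]
        rcases lt_trichotomy j i with h | h | h
        · simp [h, h.le]
        · subst h; simp
        · rcases eq_or_ne j (i + 1) with h' | h'
          · subst h'
            simpa using (dvd_sub_comm).mp (dvd_refl (xVar i - tVar i))
          · simp [h.not_ge, h.not_gt, h.ne', h']
      · simp [bsPlus, bsMinus]
    have h : bsPlus i (p * MvPolynomial.X v) - bsMinus i (p * MvPolynomial.X v)
        = bsPlus i p * (bsPlus i (MvPolynomial.X v) - bsMinus i (MvPolynomial.X v))
          + (bsPlus i p - bsMinus i p) * bsMinus i (MvPolynomial.X v) := by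
      simp only [map_mul]; ring
    rw [h]
    exact dvd_add (dvd_mul_of_dvd_right hv _) (dvd_mul_of_dvd_left hp _)

/-- The equivariant trimming operation, the quotient of `bsPlus i f - bsMinus i f` by
`x i - t i`. -/
def eqTrim (i : ℕ) (f : PolTX) : PolTX := (dvd_bsPlus_sub_bsMinus i f).choose

theorem mul_eqTrim (i : ℕ) (f : PolTX) :
    (xVar i - tVar i) * eqTrim i f = bsPlus i f - bsMinus i f :=
  (dvd_bsPlus_sub_bsMinus i f).choose_spec.symm

/-- `f(x; t) ↦ f(x; t_0, …, t_{i-1}, t_{i+1}, …)`. -/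
def omitT (i : ℕ) : PolTX →ₐ[ℤ] PolTX :=
  MvPolynomial.rename (Sum.map id fun j => if j < i then j else j + 1)

/-- `f(x; t) ↦ f(t_{σ(0)}, t_{σ(1)}, …; t)`. -/
def evPerm (σ : Equiv.Perm ℕ) : PolTX →ₐ[ℤ] PolT :=
  MvPolynomial.aeval (Sum.elim (fun i => MvPolynomial.X (σ i)) MvPolynomial.X)

open Classical in
/-- The properties that single out the family of double forest polynomials. -/
structure IsDoubleForestFamily (P : IndexedForest → PolTX) : Prop where
  homogeneous : ∀ F, ∃ d, (P F).IsHomogeneous d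
  normalized : ∀ F, evPerm 1 (P F) = if F = IndexedForest.empty then 1 else 0
  trimming : ∀ F i, eqTrim i (P F) = if i ∈ F.qdes then omitT i (P (F.trim i)) else 0

/-- The double forest polynomials: the (unique) family with these properties. -/
def doubleForestPoly : IndexedForest → PolTX := Classical.epsilon IsDoubleForestFamily

end

/-! ### Noncrossing permutations and their reduced words -/

/-- The long backwards cycle `(a_p ⋯ a_1)` on a block `{a_p > ⋯ > a_1}`: it maps each `a_k` to
`a_{k-1}`, and `a_1` to `a_p`. -/
def backwardCycle (B : Finset ℕ) : Equiv.Perm ℕ := (B.sort (· ≥ ·)).formPerm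

/-- A set partition of `{0, …, n - 1}` without crossing blocks. -/
def IsNoncrossingPartition {n : ℕ} (P : Finpartition (Finset.range n)) : Prop :=
  ∀ A ∈ P.parts, ∀ B ∈ P.parts, A ≠ B →
    ∀ a ∈ A, ∀ b ∈ A, ∀ c ∈ B, ∀ d ∈ B, ¬ (a < c ∧ c < b ∧ b < d)

/-- `σ ∈ NC_n`, where `S_n` is the group of permutations of `ℕ` that fix every `a ≥ n`: the
permutation `σ` is the product of the backwards cycles on the blocks of a noncrossing partition. -/
def IsNoncrossingPerm (n : ℕ) (σ : Equiv.Perm ℕ) : Prop :=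
  (∀ a, n ≤ a → σ a = a) ∧
    ∃ P : Finpartition (Finset.range n), IsNoncrossingPartition P ∧
      ∀ B ∈ P.parts, ∀ a ∈ B, σ a = backwardCycle B a

/-- The Coxeter length of `σ ∈ S_n`, the number of its inversions. -/
def permLength (n : ℕ) (σ : Equiv.Perm ℕ) : ℕ :=
  ((Finset.range n ×ˢ Finset.range n).filter fun p => p.1 < p.2 ∧ σ p.2 < σ p.1).card

/-- The simple transposition exchanging `i` and `i + 1`. -/
def simpleTransposition (i : ℕ) : Equiv.Perm ℕ := Equiv.swap i (i + 1)

/-- The product `s_{i_1} ⋯ s_{i_ℓ}` of a word `(i_1, …, i_ℓ)`. -/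
def wordPerm (ω : List ℕ) : Equiv.Perm ℕ := (ω.map simpleTransposition).prod

/-- `i` is a noncrossing descent of `σ ∈ NC_n`. -/
def IsNoncrossingDescent (n : ℕ) (σ : Equiv.Perm ℕ) (i : ℕ) : Prop :=
  i + 1 < n ∧ IsNoncrossingPerm n (σ * simpleTransposition i) ∧
    permLength n (σ * simpleTransposition i) < permLength n σ

/-- `ω` is a noncrossing reduced word for `σ`. -/
def IsNoncrossingReducedWord (n : ℕ) (σ : Equiv.Perm ℕ) (ω : List ℕ) : Prop :=
  wordPerm ω = σ ∧ ∀ k : Fin ω.length,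
    IsNoncrossingPerm n (wordPerm (ω.take (k + 1))) ∧
      IsNoncrossingDescent n (wordPerm (ω.take (k + 1))) (ω.get k)

/-! ### Subwords -/

/-- The subword of `ω` on a set of positions. -/
def subwordAt (ω : List ℕ) (S : Finset (Fin ω.length)) : List ℕ :=
  (S.sort (· ≤ ·)).map ω.get

open Classical in
/-- The subwords of `ω`, as sets of positions, that are Sylvester words of `F`. -/
noncomputable def sylvesterSubwords (ω : List ℕ) (F : IndexedForest) :
    Finset (Finset (Fin ω.length)) :=
  Finset.univ.filter fun S => F.IsSylvester (subwordAt ω S)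

/-- The product over the positions `p` of a subword of `t_{τ(i_p + 1)} - t_{τ(i_p)}`, where `τ` is
the product of the simple transpositions of the letters of `ω` before position `p`. -/
noncomputable def subwordWeight (ω : List ℕ) (S : Finset (Fin ω.length)) : PolT :=
  ∏ p ∈ S, (MvPolynomial.X (wordPerm (ω.take p) (ω.get p + 1))
    - MvPolynomial.X (wordPerm (ω.take p) (ω.get p)))

/-!
Double forest polynomials exist because a family of polynomials `g i` is the family of trimmings
of one polynomial as soon as it is compatible with the relations between the trimming operators;
the forest is recorded in this recursion by its code, which determines it and which trims in the
same way.

The evaluation formula is proved by induction on the word, for all words in which each letter `i`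
is applied to a permutation `σ` with `σ i = i` or `σ (i + 1) = i`.  Both `ev_σ f` and `ev_{σ s_i} f`
then substitute `t_i` at one of the positions `i`, `i + 1`, so that they differ by
`t_{σ (i + 1)} - t_{σ i}` times an evaluation of `E_i f`, which is `0` or a renumbered `P_{F / i}`.
This matches the subwords that end with the last letter of the word: the Sylvester words of `F`
that end with `i` are those of `F / i`, renumbered so as to avoid `i`, followed by `i`.
-/

open MvPolynomial
open BinaryTree (nil node numLeaves)

/-! ### Renumbering maps -/

/-- The increasing map `ℕ → ℕ` whose range omits exactly `i`. -/
def skip (i j : ℕ) : ℕ := if j < i then j else j + 1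

/-- The increasing surjection `ℕ → ℕ` that identifies `i` and `i + 1`; it is left inverse to both
`skip i` and `skip (i + 1)`. -/
def collapse (i j : ℕ) : ℕ := if j ≤ i then j else j - 1

theorem skip_of_lt {i j : ℕ} (h : j < i) : skip i j = j := if_pos h

theorem skip_of_le {i j : ℕ} (h : i ≤ j) : skip i j = j + 1 := if_neg h.not_gt

theorem collapse_of_le {i j : ℕ} (h : j ≤ i) : collapse i j = j := if_pos h

theorem collapse_of_lt {i j : ℕ} (h : i < j) : collapse i j = j - 1 := if_neg h.not_ge

theorem skip_ne (i j : ℕ) : skip i j ≠ i := by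
  unfold skip
  split_ifs <;> omega

theorem skip_injective (i : ℕ) : Function.Injective (skip i) := by
  intro j k h
  unfold skip at h
  split_ifs at h <;> omega

theorem exists_skip_eq {i j : ℕ} (h : j ≠ i) : ∃ k, skip i k = j := by
  rcases lt_or_gt_of_ne h with h | h
  · exact ⟨j, skip_of_lt h⟩
  · exact ⟨j - 1, by rw [skip_of_le (by omega)]; omega⟩

/-! ### Insertion and trimming operators -/

theorem dvd_sub_of_forall_X {R σ A : Type*} [CommRing R] [CommRing A] [Algebra R A]
    (φ ψ : MvPolynomial σ R →ₐ[R] A) {d : A} (h : ∀ v, d ∣ φ (X v) - ψ (X v))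
    (f : MvPolynomial σ R) : d ∣ φ f - ψ f := by
  let π := Ideal.Quotient.mkₐ R (Ideal.span {d})
  have hπ : ∀ a b, π a = π b ↔ d ∣ a - b := fun a b => by
    rw [← Ideal.mem_span_singleton]
    exact Ideal.Quotient.mk_eq_mk_iff_sub_mem a b
  have : π.comp φ = π.comp ψ := algHom_ext fun v => (hπ _ _).mpr (h v)
  exact (hπ _ _).mp (DFunLike.congr_fun this f)

theorem polTX_algHom_ext {A : Type*} [CommSemiring A] [Algebra ℤ A]
    {φ ψ : PolTX →ₐ[ℤ] A}
    (hx : ∀ j, φ (xVar j) = ψ (xVar j)) (ht : ∀ j, φ (tVar j) = ψ (tVar j)) : φ = ψ :=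
  algHom_ext (Sum.rec hx ht)

noncomputable section

/-- The substitution `f ↦ f(x_0, …, x_{p-1}, t_a, x_p, …; t)`. -/
def insertT (p a : ℕ) : PolTX →ₐ[ℤ] PolTX :=
  aeval (Sum.elim (fun j => if j = p then tVar a else xVar (collapse p j)) tVar)

theorem insertT_xVar (p a j : ℕ) :
    insertT p a (xVar j) = if j = p then tVar a else xVar (collapse p j) := by
  simp [insertT, xVar]

theorem insertT_xVar_self (p a : ℕ) : insertT p a (xVar p) = tVar a := by
  rw [insertT_xVar, if_pos rfl]

theorem insertT_xVar_of_lt {p j : ℕ} (h : j < p) (a : ℕ) : insertT p a (xVar j) = xVar j := by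
  rw [insertT_xVar, if_neg h.ne, collapse_of_le h.le]

theorem insertT_xVar_succ_of_le {p j : ℕ} (h : p ≤ j) (a : ℕ) :
    insertT p a (xVar (j + 1)) = xVar j := by
  rw [insertT_xVar, if_neg (by omega), collapse_of_lt (by omega), Nat.add_sub_cancel]

theorem insertT_tVar (p a j : ℕ) : insertT p a (tVar j) = tVar j := by
  simp [insertT, tVar]

theorem omitT_xVar (i j : ℕ) : omitT i (xVar j) = xVar j := by
  simp [omitT, xVar]

theorem omitT_tVar (i j : ℕ) : omitT i (tVar j) = tVar (skip i j) := by
  simp [omitT, tVar, skip]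

theorem bsMinus_eq_insertT (i : ℕ) : bsMinus i = insertT i i := by
  refine polTX_algHom_ext (fun j => ?_) fun j => ?_
  · simp only [bsMinus, xVar, aeval_X, Sum.elim_inl, insertT, collapse]
    split_ifs <;> first | rfl | omega
  · simp [bsMinus, tVar, insertT]

theorem bsPlus_eq_insertT (i : ℕ) : bsPlus i = insertT (i + 1) i := by
  refine polTX_algHom_ext (fun j => ?_) fun j => ?_
  · simp only [bsPlus, xVar, aeval_X, Sum.elim_inl, insertT, collapse]
    split_ifs <;> first | rfl | omega
  · simp [bsPlus, tVar, insertT]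

theorem insertT_insertT {p q : ℕ} (h : p ≤ q) (a b : ℕ) (f : PolTX) :
    insertT q b (insertT p a f) = insertT p a (insertT (q + 1) b f) := by
  suffices (insertT q b).comp (insertT p a) = (insertT p a).comp (insertT (q + 1) b) from
    DFunLike.congr_fun this f
  refine polTX_algHom_ext (fun j => ?_) fun j => ?_
  · simp only [AlgHom.comp_apply, insertT_xVar, collapse, apply_ite (insertT _ _), insertT_tVar]
    split_ifs <;> first | rfl | omega
  · simp only [AlgHom.comp_apply, insertT_tVar]

theorem insertT_omitT (p a i : ℕ) (f : PolTX) :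
    insertT p (skip i a) (omitT i f) = omitT i (insertT p a f) := by
  suffices (insertT p (skip i a)).comp (omitT i) = (omitT i).comp (insertT p a) from
    DFunLike.congr_fun this f
  refine polTX_algHom_ext (fun j => ?_) fun j => ?_
  · simp only [AlgHom.comp_apply, omitT_xVar, insertT_xVar, apply_ite (omitT i), omitT_tVar]
  · simp only [AlgHom.comp_apply, omitT_tVar, insertT_tVar]

theorem omitT_omitT {i j : ℕ} (h : i ≤ j) (f : PolTX) :
    omitT i (omitT j f) = omitT (j + 1) (omitT i f) := by
  suffices (omitT i).comp (omitT j) = (omitT (j + 1)).comp (omitT i) from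
    DFunLike.congr_fun this f
  refine polTX_algHom_ext (fun k => ?_) fun k => ?_
  · simp only [AlgHom.comp_apply, omitT_xVar]
  · simp only [AlgHom.comp_apply, omitT_tVar, skip]
    congr 1
    split_ifs <;> omega

theorem xVar_sub_tVar_ne_zero (i a : ℕ) : xVar i - tVar a ≠ 0 :=
  sub_ne_zero.mpr fun h => Sum.inl_ne_inr (X_injective h)

theorem dvd_insertT_sub_insertT (i a : ℕ) (f : PolTX) :
    xVar i - tVar a ∣ insertT (i + 1) a f - insertT i a f := by
  refine dvd_sub_of_forall_X _ _ (Sum.rec (fun j => ?_) fun j => ?_) f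
  · change _ ∣ insertT (i + 1) a (xVar j) - insertT i a (xVar j)
    rcases lt_trichotomy j i with h | rfl | h
    · rw [insertT_xVar_of_lt (by omega), insertT_xVar_of_lt h, sub_self]
      exact dvd_zero _
    · rw [insertT_xVar_of_lt (Nat.lt_succ_self j), insertT_xVar_self]
    · obtain ⟨j, rfl⟩ := Nat.exists_eq_succ_of_ne_zero h.ne_bot
      rw [insertT_xVar_succ_of_le (Nat.lt_succ_iff.mp h)]
      rcases eq_or_lt_of_le (Nat.lt_succ_iff.mp h) with rfl | h
      · rw [insertT_xVar_self, dvd_sub_comm]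
      · rw [insertT_xVar_succ_of_le h, sub_self]
        exact dvd_zero _
  · change _ ∣ insertT (i + 1) a (tVar j) - insertT i a (tVar j)
    rw [insertT_tVar, insertT_tVar, sub_self]
    exact dvd_zero _

theorem choose_dvd_insertT_add (i a : ℕ) (f g : PolTX) :
    (dvd_insertT_sub_insertT i a (f + g)).choose =
      (dvd_insertT_sub_insertT i a f).choose + (dvd_insertT_sub_insertT i a g).choose := by
  refine mul_left_cancel₀ (xVar_sub_tVar_ne_zero i a) ?_
  rw [mul_add, ← (dvd_insertT_sub_insertT i a (f + g)).choose_spec,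
    ← (dvd_insertT_sub_insertT i a f).choose_spec, ← (dvd_insertT_sub_insertT i a g).choose_spec,
    map_add, map_add, add_sub_add_comm]

/-- The trimming operator
`f ↦ (f(x_0, …, x_i, t_a, x_{i+1}, …; t) - f(x_0, …, t_a, x_i, x_{i+1}, …; t)) / (x_i - t_a)`
at position `i`, with a parameter `t_a` that need not be `t_i`. -/
def trimAt (i a : ℕ) : PolTX →+ PolTX :=
  AddMonoidHom.mk' (fun f => (dvd_insertT_sub_insertT i a f).choose) (choose_dvd_insertT_add i a)

theorem mul_trimAt (i a : ℕ) (f : PolTX) :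
    (xVar i - tVar a) * trimAt i a f = insertT (i + 1) a f - insertT i a f :=
  (dvd_insertT_sub_insertT i a f).choose_spec.symm

theorem trimAt_eq_of_mul {i a : ℕ} {f g : PolTX}
    (h : (xVar i - tVar a) * g = insertT (i + 1) a f - insertT i a f) : trimAt i a f = g :=
  mul_left_cancel₀ (xVar_sub_tVar_ne_zero i a) ((mul_trimAt i a f).trans h.symm)

theorem trimAt_eq_zero {i a : ℕ} {f : PolTX} (h : insertT (i + 1) a f = insertT i a f) :
    trimAt i a f = 0 :=
  trimAt_eq_of_mul (by rw [mul_zero, h, sub_self])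

theorem eqTrim_eq_trimAt (i : ℕ) (f : PolTX) : eqTrim i f = trimAt i i f :=
  (trimAt_eq_of_mul (by rw [mul_eqTrim, bsPlus_eq_insertT, bsMinus_eq_insertT])).symm

theorem trimAt_omitT (j a i : ℕ) (f : PolTX) :
    trimAt j (skip i a) (omitT i f) = omitT i (trimAt j a f) := by
  refine trimAt_eq_of_mul ?_
  rw [insertT_omitT, insertT_omitT, ← map_sub, ← mul_trimAt, map_mul, map_sub, omitT_xVar,
    omitT_tVar]

theorem trimAt_trimAt {i j : ℕ} (h : i < j) (a b : ℕ) (f : PolTX) :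
    trimAt j b (trimAt i a f) = trimAt i a (trimAt (j + 1) b f) := by
  refine trimAt_eq_of_mul (mul_left_cancel₀ (xVar_sub_tVar_ne_zero i a) ?_)
  have mul_left (q : ℕ) (hq : i < q) : (xVar i - tVar a) * insertT q b (trimAt i a f) =
      insertT q b (insertT (i + 1) a f) - insertT q b (insertT i a f) := by
    rw [← map_sub, ← mul_trimAt, map_mul, map_sub, insertT_xVar_of_lt hq, insertT_tVar]
  have mul_right (p : ℕ) (hp : p ≤ j) : (xVar j - tVar b) * insertT p a (trimAt (j + 1) b f) =
      insertT p a (insertT (j + 1 + 1) b f) - insertT p a (insertT (j + 1) b f) := by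
    rw [← map_sub, ← mul_trimAt, map_mul, map_sub, insertT_xVar_succ_of_le hp, insertT_tVar]
  rw [mul_left_comm, mul_trimAt, mul_sub, mul_sub, mul_left _ h, mul_left _ (by omega),
    mul_right _ (by omega), mul_right _ (by omega),
    insertT_insertT (by omega : i + 1 ≤ j + 1), insertT_insertT (by omega : i + 1 ≤ j),
    insertT_insertT (by omega : i ≤ j + 1), insertT_insertT (by omega : i ≤ j)]
  ring

/-! ### Polynomials in the first variables -/

theorem mem_supported_of_mul_mem {σ R : Type*} [CommRing R] [NoZeroDivisors R] {s : Set σ}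
    {f g : MvPolynomial σ R} (hf : f ≠ 0) (hfg : f * g ∈ supported R s) : g ∈ supported R s := by
  rcases eq_or_ne g 0 with rfl | hg
  · exact zero_mem _
  · refine mem_supported.mpr fun v hv => mem_supported.mp hfg ?_
    simp only [SetLike.mem_coe, mem_vars_iff_degreeOf_ne_zero, degreeOf_mul_eq hf hg] at hv ⊢
    omega

/-- The polynomials that involve no `x_j` with `j ≥ m`. -/
def firstVars (m : ℕ) : Subalgebra ℤ PolTX :=
  supported ℤ (Sum.inl '' Set.Iio m ∪ Set.range Sum.inr)

theorem xVar_mem_firstVars {j m : ℕ} (h : j < m) : xVar j ∈ firstVars m :=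
  X_mem_supported.mpr (.inl ⟨j, h, rfl⟩)

theorem tVar_mem_firstVars (j m : ℕ) : tVar j ∈ firstVars m :=
  X_mem_supported.mpr (.inr ⟨j, rfl⟩)

theorem rename_inr_mem_firstVars (m : ℕ) (g : PolT) : rename Sum.inr g ∈ firstVars m := by
  classical
  refine mem_supported.mpr fun v hv => .inr ?_
  obtain ⟨j, -, rfl⟩ := Finset.mem_image.mp (vars_rename _ _ hv)
  exact ⟨j, rfl⟩

theorem firstVars_mono {k m : ℕ} (h : k ≤ m) : firstVars k ≤ firstVars m :=
  supported_mono (Set.union_subset_union_left _ (Set.image_mono (Set.Iio_subset_Iio h)))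

theorem firstVars_le {m : ℕ} {S : Subalgebra ℤ PolTX} (hx : ∀ j < m, xVar j ∈ S)
    (ht : ∀ j, tVar j ∈ S) : firstVars m ≤ S := by
  refine Algebra.adjoin_le ?_
  rintro _ ⟨_, ⟨j, hj, rfl⟩ | ⟨j, rfl⟩, rfl⟩
  exacts [hx j hj, ht j]

section

variable {m : ℕ} {f : PolTX}

theorem omitT_mem_firstVars (hf : f ∈ firstVars m) (i : ℕ) : omitT i f ∈ firstVars m := by
  refine firstVars_le (S := (firstVars m).comap (omitT i)) (fun j hj => ?_) (fun j => ?_) hf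
  · rw [Subalgebra.mem_comap, omitT_xVar]
    exact xVar_mem_firstVars hj
  · rw [Subalgebra.mem_comap, omitT_tVar]
    exact tVar_mem_firstVars _ _

theorem insertT_mem_firstVars (hf : f ∈ firstVars (m + 1)) {p : ℕ} (h : p ≤ m) (a : ℕ) :
    insertT p a f ∈ firstVars m := by
  refine firstVars_le (S := (firstVars m).comap (insertT p a)) (fun j hj => ?_) (fun j => ?_) hf
  · rw [Subalgebra.mem_comap, insertT_xVar, collapse]
    split_ifs
    exacts [tVar_mem_firstVars _ _, xVar_mem_firstVars (by omega), xVar_mem_firstVars (by omega)]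
  · rw [Subalgebra.mem_comap, insertT_tVar]
    exact tVar_mem_firstVars _ _

theorem insertT_eq_self (hf : f ∈ firstVars m) {p : ℕ} (h : m ≤ p) (a : ℕ) :
    insertT p a f = f :=
  firstVars_le (S := AlgHom.equalizer (insertT p a) (AlgHom.id ℤ PolTX))
    (fun _ hj => insertT_xVar_of_lt (hj.trans_le h) a) (insertT_tVar p a) hf

theorem trimAt_mem_firstVars (hf : f ∈ firstVars (m + 1)) {i : ℕ} (h : i < m) (a : ℕ) :
    trimAt i a f ∈ firstVars m := by
  refine mem_supported_of_mul_mem (xVar_sub_tVar_ne_zero i a) ?_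
  rw [mul_trimAt]
  exact sub_mem (insertT_mem_firstVars hf h a) (insertT_mem_firstVars hf h.le a)

theorem trimAt_eq_zero_of_mem_firstVars (hf : f ∈ firstVars m) {i : ℕ} (h : m ≤ i) (a : ℕ) :
    trimAt i a f = 0 :=
  trimAt_eq_zero (by rw [insertT_eq_self hf h, insertT_eq_self hf (by omega)])

end

/-! ### Homogeneity -/

theorem isHomogeneous_of_mul {σ R : Type*} [CommRing R] [NoZeroDivisors R]
    {f g : MvPolynomial σ R} {d e : ℕ} (hf : f.IsHomogeneous d) (hf₀ : f ≠ 0)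
    (hfg : (f * g).IsHomogeneous (d + e)) : g.IsHomogeneous e := by
  let _ : GradedAlgebra (homogeneousSubmodule σ R) := gradedAlgebra
  have component_eq_zero (k : ℕ) (hk : k ≠ e) : homogeneousComponent k g = 0 := by
    have h := DirectSum.coe_decompose_mul_add_of_left_mem
      (homogeneousSubmodule σ R) (j := k) (b := g) hf
    rw [DirectSum.decompose_of_mem_ne (homogeneousSubmodule σ R) hfg (by omega), eq_comm,
      mul_eq_zero, or_iff_right hf₀] at h
    rwa [← decomposition.decompose'_apply]
  intro v hv
  by_contra h
  have hv_degree : v.degree ≠ e := by rwa [Finsupp.degree_eq_weight_one]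
  have := coeff_homogeneousComponent v.degree g v
  rw [if_pos rfl, component_eq_zero _ hv_degree, coeff_zero] at this
  exact hv this.symm

theorem isHomogeneous_xVar_sub_tVar (i a : ℕ) : (xVar i - tVar a).IsHomogeneous 1 :=
  (isHomogeneous_X _ _).sub (isHomogeneous_X _ _)

section

variable {f : PolTX} {d : ℕ}

theorem isHomogeneous_insertT (hf : f.IsHomogeneous d) (p a : ℕ) :
    (insertT p a f).IsHomogeneous d := by
  rw [← one_mul d]
  refine IsHomogeneous.aeval hf _ (Sum.rec (fun j => ?_) fun j => isHomogeneous_X _ _)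
  rw [Sum.elim_inl]
  split_ifs <;> exact isHomogeneous_X _ _

theorem isHomogeneous_trimAt (hf : f.IsHomogeneous (d + 1)) (i a : ℕ) :
    (trimAt i a f).IsHomogeneous d := by
  refine isHomogeneous_of_mul (isHomogeneous_xVar_sub_tVar i a) (xVar_sub_tVar_ne_zero i a) ?_
  rw [mul_trimAt, add_comm 1 d]
  exact (isHomogeneous_insertT hf _ _).sub (isHomogeneous_insertT hf _ _)

theorem isHomogeneous_evPerm (hf : f.IsHomogeneous d) (σ : Equiv.Perm ℕ) :
    (evPerm σ f).IsHomogeneous d := by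
  rw [← one_mul d]
  exact IsHomogeneous.aeval hf _
    (Sum.rec (fun j => isHomogeneous_X _ _) fun j => isHomogeneous_X _ _)

end

/-! ### Common primitives of compatible families -/

theorem trimAt_xVar_sub_tVar_mul {i m : ℕ} (h : i < m) (b : ℕ) (f : PolTX) :
    trimAt i i ((xVar (m + 1) - tVar b) * f) = (xVar m - tVar b) * trimAt i i f := by
  refine trimAt_eq_of_mul ?_
  rw [mul_left_comm, mul_trimAt]
  simp only [map_mul, map_sub, insertT_tVar]
  rw [insertT_xVar_succ_of_le h, insertT_xVar_succ_of_le h.le, mul_sub]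

theorem trimAt_xVar_sub_tVar_mul_self {m : ℕ} {f : PolTX} (hf : f ∈ firstVars (m + 1)) :
    trimAt m m ((xVar m - tVar m) * f) = f := by
  refine trimAt_eq_of_mul ?_
  rw [map_mul, map_mul, insertT_eq_self hf le_rfl, map_sub, map_sub, insertT_tVar, insertT_tVar,
    insertT_xVar_self, insertT_xVar_of_lt m.lt_succ_self, sub_self, zero_mul, sub_zero]

theorem sub_trimAt_eq_insertT {i k : ℕ} {f g : PolTX} (hik : i < k) (hf : f ∈ firstVars (k + 1))
    (hfg : trimAt k (k + 1) f = trimAt i i g) :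
    f - trimAt i i ((xVar (k + 1) - tVar (k + 1)) * g) = insertT k (k + 1) f := by
  rw [trimAt_xVar_sub_tVar_mul hik, ← hfg, mul_trimAt, insertT_eq_self hf le_rfl, sub_sub_cancel]

/-- The top operator is inverted by multiplication with `x_m - t_m`; subtracting the contribution
of that primitive from the other members leaves a compatible family in one variable less. -/
theorem exists_trimAt_eq (d m : ℕ) (g : ℕ → PolTX) (hd : ∀ i < m, (g i).IsHomogeneous d)
    (hv : ∀ i < m, g i ∈ firstVars (max (i + 1) (m - 1)))
    (hc : ∀ i j, i < j → j + 1 < m → trimAt j (j + 1) (g i) = trimAt i i (g (j + 1))) :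
    ∃ f ∈ firstVars m, f.IsHomogeneous (d + 1) ∧ ∀ i < m, trimAt i i f = g i := by
  induction m generalizing g with
  | zero => exact ⟨0, zero_mem _, isHomogeneous_zero _ _ _, by simp⟩
  | succ m ih =>
    have hvm : ∀ i < m, g i ∈ firstVars m := fun i hi =>
      firstVars_mono (by omega) (hv i (by omega))
    have hgm : g m ∈ firstVars (m + 1) := firstVars_mono (by omega) (hv m (by omega))
    set h : PolTX := (xVar m - tVar m) * g m with h_def
    have hhv : h ∈ firstVars (m + 1) :=
      mul_mem (sub_mem (xVar_mem_firstVars m.lt_succ_self) (tVar_mem_firstVars _ _)) hgm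
    have hhd : h.IsHomogeneous (d + 1) :=
      add_comm 1 d ▸ (isHomogeneous_xVar_sub_tVar m m).mul (hd m m.lt_succ_self)
    obtain ⟨f, hfv, hfd, hf⟩ := ih (fun i => g i - trimAt i i h)
      (fun i hi => (hd i (by omega)).sub (isHomogeneous_trimAt hhd i i))
      (fun i hi => by
        rcases eq_or_lt_of_le (Nat.succ_le_of_lt hi) with rfl | hi'
        · exact firstVars_mono (by omega) (sub_mem (hvm i hi) (trimAt_mem_firstVars hhv hi i))
        · obtain ⟨k, rfl⟩ := Nat.exists_eq_succ_of_ne_zero hi.ne_bot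
          simp only [h_def, sub_trimAt_eq_insertT (Nat.lt_of_succ_lt_succ hi') (hvm i hi)
            (hc i k (Nat.lt_of_succ_lt_succ hi') (by omega))]
          exact firstVars_mono (by omega) (insertT_mem_firstVars (hvm i hi) le_rfl _))
      (fun i j hij hjm => by
        rw [map_sub, map_sub, hc i j hij (by omega), trimAt_trimAt hij])
    refine ⟨h + f, add_mem hhv (firstVars_mono m.le_succ hfv), hhd.add hfd, fun i hi => ?_⟩
    rw [map_add]
    rcases Nat.lt_succ_iff_lt_or_eq.mp hi with hi | rfl
    · rw [hf i hi, add_sub_cancel]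
    · rw [trimAt_eq_zero_of_mem_firstVars hfv le_rfl, add_zero, h_def,
        trimAt_xVar_sub_tVar_mul_self hgm]

/-! ### Polynomials indexed by codes -/

/-- The effect of trimming at `i` on a code.  Codes are the multisets of leftmost leaves of the
internal nodes of a forest; the definition makes sense for every multiset. -/
def trimCode (c : Multiset ℕ) (i : ℕ) : Multiset ℕ := (c.erase i).map (collapse i)

/-- The positions at which a code may be trimmed, corresponding to the terminal nodes of a
forest. -/
def codeQDes (c : Multiset ℕ) : Set ℕ := {i | i ∈ c ∧ i + 1 ∉ c}

theorem mem_trimCode_of_lt {c : Multiset ℕ} {i j : ℕ} (h : i < j) :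
    j ∈ trimCode c i ↔ j + 1 ∈ c := by
  rw [trimCode, Multiset.mem_map]
  constructor
  · rintro ⟨b, hb, rfl⟩
    rcases le_or_gt b i with hbi | hbi
    · rw [collapse_of_le hbi] at h
      omega
    · rw [collapse_of_lt hbi, Nat.sub_add_cancel (by omega)]
      exact Multiset.mem_of_mem_erase hb
  · exact fun hj => ⟨j + 1, (Multiset.mem_erase_of_ne (by omega)).mpr hj, collapse_of_lt (by omega)⟩

theorem mem_trimCode_of_gt {c : Multiset ℕ} {i j : ℕ} (h : j < i) :
    j ∈ trimCode c i ↔ j ∈ c := by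
  rw [trimCode, Multiset.mem_map]
  constructor
  · rintro ⟨b, hb, rfl⟩
    rcases le_or_gt b i with hbi | hbi
    · rw [collapse_of_le hbi]
      exact Multiset.mem_of_mem_erase hb
    · rw [collapse_of_lt hbi] at h
      omega
  · exact fun hj => ⟨j, (Multiset.mem_erase_of_ne h.ne).mpr hj, collapse_of_le h.le⟩

theorem mem_codeQDes_trimCode_of_lt {c : Multiset ℕ} {i j : ℕ} (h : i < j) :
    j ∈ codeQDes (trimCode c i) ↔ j + 1 ∈ codeQDes c :=
  and_congr (mem_trimCode_of_lt h) (mem_trimCode_of_lt (by omega)).not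

theorem mem_codeQDes_trimCode_of_gt {c : Multiset ℕ} {i j : ℕ} (h : i < j) :
    i ∈ codeQDes (trimCode c (j + 1)) ↔ i ∈ codeQDes c :=
  and_congr (mem_trimCode_of_gt (by omega)) (mem_trimCode_of_gt (by omega)).not

theorem trimCode_trimCode {c : Multiset ℕ} {i j : ℕ} (h : i < j) (hi : i ∈ c) (hj : j + 1 ∈ c) :
    trimCode (trimCode c i) j = trimCode (trimCode c (j + 1)) i := by
  obtain ⟨c, rfl⟩ := Multiset.exists_cons_of_mem hi
  rw [Multiset.mem_cons, or_iff_right (by omega)] at hj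
  obtain ⟨c, rfl⟩ := Multiset.exists_cons_of_mem hj
  have collapse_right : collapse i (j + 1) = j := collapse_of_lt (by omega)
  have collapse_left : collapse (j + 1) i = i := collapse_of_le (by omega)
  rw [trimCode, trimCode, Multiset.erase_cons_head, Multiset.map_cons, collapse_right,
    Multiset.erase_cons_head, Multiset.cons_swap, trimCode, trimCode, Multiset.erase_cons_head,
    Multiset.map_cons, collapse_left, Multiset.erase_cons_head, Multiset.map_map,
    Multiset.map_map]
  refine Multiset.map_congr rfl fun b _ => ?_
  simp only [Function.comp_apply, collapse]
  split_ifs <;> omega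

theorem card_trimCode {c : Multiset ℕ} {i : ℕ} (hi : i ∈ c) :
    (trimCode c i).card + 1 = c.card := by
  rw [trimCode, Multiset.card_map, Multiset.card_erase_add_one hi]

/-- The least strict upper bound of the elements of a code. -/
def codeBound (c : Multiset ℕ) : ℕ := (c.map (· + 1)).sup

theorem codeBound_le {c : Multiset ℕ} {m : ℕ} : codeBound c ≤ m ↔ ∀ b ∈ c, b < m := by
  simp [codeBound, Multiset.sup_le]

theorem lt_codeBound {c : Multiset ℕ} {b : ℕ} (h : b ∈ c) : b < codeBound c :=
  codeBound_le.mp le_rfl b h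

theorem codeBound_trimCode_le (c : Multiset ℕ) (i : ℕ) :
    codeBound (trimCode c i) ≤ max (i + 1) (codeBound c - 1) := by
  refine codeBound_le.mpr fun b hb => ?_
  obtain ⟨b, hbc, rfl⟩ := Multiset.mem_map.mp hb
  have := lt_codeBound (Multiset.mem_of_mem_erase hbc)
  unfold collapse
  split_ifs <;> omega

open Classical in
/-- The conditions that determine the polynomial `f` of the code `c`, when its images under the
trimming operators are prescribed to be the `g i`. -/
structure IsTrimmingPrimitive (c : Multiset ℕ) (g : ℕ → PolTX) (f : PolTX) : Prop where
  homogeneous : f.IsHomogeneous c.card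
  mem_firstVars : f ∈ firstVars (codeBound c)
  normalized : evPerm 1 f = if c = 0 then 1 else 0
  trimming : ∀ i, trimAt i i f = g i

open Classical in
/-- The double forest polynomial of a forest with code `c`, chosen recursively as the primitive of
the polynomials of the trimmed codes. -/
def codePoly (c : Multiset ℕ) : PolTX :=
  Classical.epsilon (IsTrimmingPrimitive c fun i =>
    if _h : i ∈ codeQDes c then omitT i (codePoly (trimCode c i)) else 0)
termination_by c.card
decreasing_by exact Nat.lt_of_succ_le (card_trimCode _h.1).le

open Classical in
/-- The image that the polynomial of the code `c` must have under the `i`-th trimming operator. -/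
def codeTrimming (c : Multiset ℕ) (i : ℕ) : PolTX :=
  if i ∈ codeQDes c then omitT i (codePoly (trimCode c i)) else 0

theorem codePoly_eq_epsilon (c : Multiset ℕ) :
    codePoly c = Classical.epsilon (IsTrimmingPrimitive c (codeTrimming c)) := by
  rw [codePoly]
  rfl

theorem codeTrimming_of_mem {c : Multiset ℕ} {i : ℕ} (h : i ∈ codeQDes c) :
    codeTrimming c i = omitT i (codePoly (trimCode c i)) := if_pos h

theorem codeTrimming_of_notMem {c : Multiset ℕ} {i : ℕ} (h : i ∉ codeQDes c) :
    codeTrimming c i = 0 := if_neg h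

section

variable {c : Multiset ℕ}
  (hc : ∀ i ∈ c, IsTrimmingPrimitive (trimCode c i) (codeTrimming (trimCode c i))
    (codePoly (trimCode c i)))
include hc

theorem isHomogeneous_codeTrimming {d : ℕ} (hd : c.card = d + 1) (i : ℕ) :
    (codeTrimming c i).IsHomogeneous d := by
  by_cases h : i ∈ codeQDes c
  · have hcard := card_trimCode h.1
    obtain rfl : (trimCode c i).card = d := by omega
    rw [codeTrimming_of_mem h]
    exact (hc i h.1).homogeneous.rename_isHomogeneous
  · rw [codeTrimming_of_notMem h]
    exact isHomogeneous_zero _ _ _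

theorem codeTrimming_mem_firstVars (i : ℕ) :
    codeTrimming c i ∈ firstVars (max (i + 1) (codeBound c - 1)) := by
  by_cases h : i ∈ codeQDes c
  · rw [codeTrimming_of_mem h]
    exact omitT_mem_firstVars (firstVars_mono (codeBound_trimCode_le c i)
      (hc i h.1).mem_firstVars) i
  · rw [codeTrimming_of_notMem h]
    exact zero_mem _

theorem trimAt_codeTrimming {i : ℕ} (h : i ∈ codeQDes c) (j : ℕ) :
    trimAt j (skip i j) (codeTrimming c i) = omitT i (codeTrimming (trimCode c i) j) := by
  rw [codeTrimming_of_mem h, trimAt_omitT, (hc i h.1).trimming]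

theorem trimAt_codeTrimming_comm {i j : ℕ} (hij : i < j) :
    trimAt j (j + 1) (codeTrimming c i) = trimAt i i (codeTrimming c (j + 1)) := by
  have trim_left (hi : i ∈ codeQDes c) := trimAt_codeTrimming hc hi j
  have trim_right (hj : j + 1 ∈ codeQDes c) := trimAt_codeTrimming hc hj i
  rw [skip_of_le hij.le] at trim_left
  rw [skip_of_lt (by omega)] at trim_right
  by_cases hi : i ∈ codeQDes c <;> by_cases hj : j + 1 ∈ codeQDes c
  · rw [trim_left hi, trim_right hj,
      codeTrimming_of_mem ((mem_codeQDes_trimCode_of_lt hij).mpr hj),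
      codeTrimming_of_mem ((mem_codeQDes_trimCode_of_gt hij).mpr hi),
      trimCode_trimCode hij hi.1 hj.1, omitT_omitT hij.le]
  · rw [trim_left hi, codeTrimming_of_notMem ((mem_codeQDes_trimCode_of_lt hij).not.mpr hj),
      codeTrimming_of_notMem hj, map_zero, map_zero]
  · rw [trim_right hj, codeTrimming_of_notMem ((mem_codeQDes_trimCode_of_gt hij).not.mpr hi),
      codeTrimming_of_notMem hi, map_zero, map_zero]
  · rw [codeTrimming_of_notMem hi, codeTrimming_of_notMem hj, map_zero, map_zero]

theorem exists_trimAt_eq_codeTrimming (h₀ : c ≠ 0) :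
    ∃ f ∈ firstVars (codeBound c), f.IsHomogeneous c.card ∧
      ∀ i, trimAt i i f = codeTrimming c i := by
  obtain ⟨d, hd⟩ := Nat.exists_eq_succ_of_ne_zero (Multiset.card_eq_zero.not.mpr h₀)
  obtain ⟨f, hfv, hfd, hf⟩ := exists_trimAt_eq d (codeBound c) (codeTrimming c)
    (fun i _ => isHomogeneous_codeTrimming hc hd i) (fun i _ => codeTrimming_mem_firstVars hc i)
    (fun _ _ hij _ => trimAt_codeTrimming_comm hc hij)
  refine ⟨f, hfv, hd ▸ hfd, fun i => ?_⟩
  rcases lt_or_ge i (codeBound c) with hi | hi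
  · exact hf i hi
  · rw [trimAt_eq_zero_of_mem_firstVars hfv hi, codeTrimming_of_notMem]
    exact fun h => (lt_codeBound h.1).not_ge hi

end

theorem trimAt_rename_inr (i a : ℕ) (g : PolT) : trimAt i a (rename Sum.inr g) = 0 := by
  have hg := rename_inr_mem_firstVars 0 g
  exact trimAt_eq_zero_of_mem_firstVars hg i.zero_le a

theorem evPerm_rename_inr (σ : Equiv.Perm ℕ) (g : PolT) : evPerm σ (rename Sum.inr g) = g := by
  rw [evPerm, aeval_rename, Sum.elim_comp_inr, aeval_X_left_apply]

theorem isTrimmingPrimitive_codePoly (c : Multiset ℕ) :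
    IsTrimmingPrimitive c (codeTrimming c) (codePoly c) := by
  induction hd : c.card using Nat.strong_induction_on generalizing c with
  | _ d ih =>
    rw [codePoly_eq_epsilon]
    refine Classical.epsilon_spec (p := IsTrimmingPrimitive c (codeTrimming c)) ?_
    rcases eq_or_ne c 0 with rfl | h₀
    · refine ⟨1, isHomogeneous_one _ _, one_mem _, by simp, fun i => ?_⟩
      rw [codeTrimming_of_notMem fun h => Multiset.notMem_zero i h.1]
      exact trimAt_eq_zero (by rw [map_one, map_one])
    · obtain ⟨f, hfv, hfd, hf⟩ := exists_trimAt_eq_codeTrimming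
        (fun i hi => ih _ (by have := card_trimCode hi; omega) (trimCode c i) rfl) h₀
      refine ⟨f - rename Sum.inr (evPerm 1 f),
        hfd.sub (isHomogeneous_evPerm hfd 1).rename_isHomogeneous,
        sub_mem hfv (rename_inr_mem_firstVars _ _), ?_, fun i => ?_⟩
      · rw [map_sub, evPerm_rename_inr, sub_self, if_neg h₀]
      · rw [map_sub, trimAt_rename_inr, sub_zero, hf]

end

/-! ### Subtrees and trimmed trees -/

theorem numLeaves_nil : (nil : BinaryTree Unit).numLeaves = 1 := rfl

theorem numLeaves_node (l r : BinaryTree Unit) :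
    (node () l r).numLeaves = l.numLeaves + r.numLeaves := rfl

theorem subtreeAt_nil_iff {a b : ℕ} {s : BinaryTree Unit} :
    SubtreeAt nil a s b ↔ s = nil ∧ b = a := by
  refine ⟨fun h => ?_, ?_⟩
  · generalize ht : (nil : BinaryTree Unit) = t at h
    induction h with
    | root => exact ⟨rfl, rfl⟩
    | left _ ih => exact absurd ih.1 (by simp [← ht])
    | right _ ih => exact absurd ih.1 (by simp [← ht])
  · rintro ⟨rfl, rfl⟩
    exact .root

theorem SubtreeAt.of_left {l r s : BinaryTree Unit} {a b : ℕ} (h : SubtreeAt l a s b) :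
    SubtreeAt (node () l r) a s b := by
  induction h with
  | root => exact .left .root
  | left _ ih => exact .left ih
  | right _ ih => exact .right ih

theorem SubtreeAt.of_right {l r s : BinaryTree Unit} {a b : ℕ}
    (h : SubtreeAt r (a + l.numLeaves) s b) : SubtreeAt (node () l r) a s b := by
  induction h with
  | root => exact .right .root
  | left _ ih => exact .left ih
  | right _ ih => exact .right ih

theorem subtreeAt_node_iff {l r s : BinaryTree Unit} {a b : ℕ} :
    SubtreeAt (node () l r) a s b ↔
      (s = node () l r ∧ b = a) ∨ SubtreeAt l a s b ∨ SubtreeAt r (a + l.numLeaves) s b := by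
  refine ⟨fun h => ?_, ?_⟩
  · induction h with
    | root => exact .inl ⟨rfl, rfl⟩
    | left _ ih =>
      rcases ih with ⟨he, rfl⟩ | h | h
      · cases he; exact .inr (.inl .root)
      · exact .inr (.inl h.left)
      · exact .inr (.inr h.left)
    | right _ ih =>
      rcases ih with ⟨he, rfl⟩ | h | h
      · cases he; exact .inr (.inr .root)
      · exact .inr (.inl h.right)
      · exact .inr (.inr h.right)
  · rintro (⟨rfl, rfl⟩ | h | h)
    · exact .root
    · exact h.of_left
    · exact h.of_right

/-- `IsTrimOf t a i t'`: if the leaves of `t` are numbered from `a`, then `t` has a terminal node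
with leftmost leaf `i`, and `t'` arises from `t` by deleting it. -/
inductive IsTrimOf : BinaryTree Unit → ℕ → ℕ → BinaryTree Unit → Prop
  | here (a : ℕ) : IsTrimOf (node () nil nil) a a nil
  | left {l l' r : BinaryTree Unit} {a i : ℕ} :
      IsTrimOf l a i l' → IsTrimOf (node () l r) a i (node () l' r)
  | right {l r r' : BinaryTree Unit} {a i : ℕ} :
      IsTrimOf r (a + l.numLeaves) i r' → IsTrimOf (node () l r) a i (node () l r')

namespace IsTrimOf

variable {t t' : BinaryTree Unit} {a i : ℕ}

theorem le (h : IsTrimOf t a i t') : a ≤ i := by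
  induction h <;> omega

theorem numLeaves_eq (h : IsTrimOf t a i t') : t.numLeaves = t'.numLeaves + 1 := by
  induction h <;> simp only [numLeaves_node, numLeaves_nil] <;> omega

theorem lt (h : IsTrimOf t a i t') : i + 1 < a + t.numLeaves := by
  induction h <;> simp only [numLeaves_node, numLeaves_nil] <;> omega

end IsTrimOf

theorem trimTree_node {l r : BinaryTree Unit} (h : l ≠ nil ∨ r ≠ nil) (i : ℕ) :
    trimTree i (node () l r) = if i < l.numLeaves then node () (trimTree i l) r
      else node () l (trimTree (i - l.numLeaves) r) := by
  rcases l with _ | ⟨⟨⟩, _, _⟩ <;> rcases r with _ | ⟨⟨⟩, _, _⟩ <;>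
    first | rfl | simp at h

theorem isTrimOf_trimTree {t : BinaryTree Unit} {a i : ℕ}
    (h : SubtreeAt t a (node () nil nil) i) : IsTrimOf t a i (trimTree (i - a) t) := by
  induction t generalizing a with
  | nil => simp [subtreeAt_nil_iff] at h
  | node _ l r ihl ihr =>
    rcases subtreeAt_node_iff.mp h with ⟨he, rfl⟩ | h | h
    · cases he
      simpa [trimTree] using IsTrimOf.here i
    · have hl := ihl h
      have := hl.le
      have := hl.lt
      rw [trimTree_node (.inl (by rintro rfl; simp [subtreeAt_nil_iff] at h)), if_pos (by omega)]
      exact .left hl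
    · have hr := ihr h
      have := hr.le
      rw [trimTree_node (.inr (by rintro rfl; simp [subtreeAt_nil_iff] at h)), if_neg (by omega),
        Nat.sub_sub]
      exact .right hr

/-! ### Codes of trees -/

/-- The code of a tree with leaves numbered from `a`: the leftmost leaves of its internal nodes. -/
def codeAt : BinaryTree Unit → ℕ → Multiset ℕ
  | .nil, _ => 0
  | .node _ l r, a => a ::ₘ (codeAt l a + codeAt r (a + l.numLeaves))

theorem mem_codeAt_node {l r : BinaryTree Unit} {a b : ℕ} : b ∈ codeAt (node () l r) a ↔
    b = a ∨ b ∈ codeAt l a ∨ b ∈ codeAt r (a + l.numLeaves) := by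
  rw [codeAt, Multiset.mem_cons, Multiset.mem_add]

theorem bounds_of_mem_codeAt {t : BinaryTree Unit} {a b : ℕ} (h : b ∈ codeAt t a) :
    a ≤ b ∧ b + 1 < a + t.numLeaves := by
  induction t generalizing a with
  | nil => exact absurd h (Multiset.notMem_zero b)
  | node _ l r ihl ihr =>
    have := l.numLeaves_pos
    have := r.numLeaves_pos
    rw [numLeaves_node]
    rcases mem_codeAt_node.mp h with rfl | h | h
    · omega
    · have := ihl h; omega
    · have := ihr h; omega

theorem mem_codeAt_self_iff {t : BinaryTree Unit} {a : ℕ} : a ∈ codeAt t a ↔ t ≠ nil := by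
  rcases t with _ | ⟨⟨⟩, l, r⟩ <;> simp [codeAt]

theorem subtreeAt_terminal_iff {t : BinaryTree Unit} {a i : ℕ} :
    SubtreeAt t a (node () nil nil) i ↔ i ∈ codeAt t a ∧ i + 1 ∉ codeAt t a := by
  induction t generalizing a with
  | nil => simp [subtreeAt_nil_iff, codeAt]
  | node _ l r ihl ihr =>
    have := l.numLeaves_pos
    have bounds_left {b : ℕ} (h : b ∈ codeAt l a) := bounds_of_mem_codeAt h
    have bounds_right {b : ℕ} (h : b ∈ codeAt r (a + l.numLeaves)) := bounds_of_mem_codeAt h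
    have hl := mem_codeAt_self_iff (t := l) (a := a)
    have hr := mem_codeAt_self_iff (t := r) (a := a + l.numLeaves)
    rw [subtreeAt_node_iff, mem_codeAt_node, mem_codeAt_node, ihl, ihr]
    grind [numLeaves_nil, codeAt, BinaryTree]

theorem map_skip_codeAt_of_le {t : BinaryTree Unit} {a i : ℕ} (h : a + t.numLeaves ≤ i + 1) :
    (codeAt t a).map (skip i) = codeAt t a := by
  conv_rhs => rw [← Multiset.map_id (codeAt t a)]
  refine Multiset.map_congr rfl fun b hb => skip_of_lt ?_
  have := bounds_of_mem_codeAt hb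
  omega

theorem map_skip_codeAt_of_ge {t : BinaryTree Unit} {a i : ℕ} (h : i ≤ a) :
    (codeAt t a).map (skip i) = codeAt t (a + 1) := by
  induction t generalizing a with
  | nil => rfl
  | node _ l r ihl ihr =>
    rw [codeAt, codeAt, Multiset.map_cons, Multiset.map_add, ihl h, ihr (by omega),
      skip_of_le h, Nat.add_right_comm]

theorem IsTrimOf.codeAt_eq {t t' : BinaryTree Unit} {a i : ℕ} (h : IsTrimOf t a i t') :
    codeAt t a = i ::ₘ (codeAt t' a).map (skip (i + 1)) := by
  induction h with
  | here => rfl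
  | @left l l' r a i h ih =>
    have := h.le
    have := h.lt
    have hll' := h.numLeaves_eq
    rw [codeAt, codeAt, Multiset.map_cons, Multiset.map_add, ih, skip_of_lt (by omega),
      map_skip_codeAt_of_ge (t := r) (by omega), hll', Nat.add_assoc, Multiset.cons_add,
      Multiset.cons_swap]
  | @right l r r' a i h ih =>
    have := h.le
    have := l.numLeaves_pos
    rw [codeAt, codeAt, Multiset.map_cons, Multiset.map_add, ih, skip_of_lt (by omega),
      map_skip_codeAt_of_le (t := l) (by omega), Multiset.add_cons, Multiset.cons_swap]

/-! ### Labels and edges -/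

/-- The root of the tree is internal, with canonical label `q`. -/
def RootLabel : BinaryTree Unit → ℕ → ℕ → Prop
  | .nil, _, _ => False
  | .node _ l _, a, q => q = a + l.numLeaves - 1

/-- Some internal node with canonical label `p` has an internal child with canonical
label `q`. -/
def LabelEdge : BinaryTree Unit → ℕ → ℕ → ℕ → Prop
  | .nil, _, _, _ => False
  | .node _ l r, a, p, q =>
      (p = a + l.numLeaves - 1 ∧ (RootLabel l a q ∨ RootLabel r (a + l.numLeaves) q)) ∨
        LabelEdge l a p q ∨ LabelEdge r (a + l.numLeaves) p q

theorem RootLabel.bounds {t : BinaryTree Unit} {a q : ℕ} (h : RootLabel t a q) :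
    a ≤ q ∧ q + 1 < a + t.numLeaves := by
  rcases t with _ | ⟨⟨⟩, l, r⟩
  · exact h.elim
  · have := l.numLeaves_pos
    have := r.numLeaves_pos
    rw [RootLabel] at h
    rw [numLeaves_node]
    omega

theorem LabelEdge.bounds {t : BinaryTree Unit} {a p q : ℕ} (h : LabelEdge t a p q) :
    (a ≤ p ∧ p + 1 < a + t.numLeaves) ∧ a ≤ q ∧ q + 1 < a + t.numLeaves := by
  induction t generalizing a with
  | nil => exact h.elim
  | node _ l r ihl ihr =>
    have := l.numLeaves_pos
    have := r.numLeaves_pos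
    rw [numLeaves_node]
    rcases h with ⟨rfl, h | h⟩ | h | h
    · have := h.bounds; omega
    · have := h.bounds; omega
    · have := ihl h; omega
    · have := ihr h; omega

theorem LabelEdge.ne {t : BinaryTree Unit} {a p q : ℕ} (h : LabelEdge t a p q) : p ≠ q := by
  induction t generalizing a with
  | nil => exact h.elim
  | node _ l r ihl ihr =>
    rcases h with ⟨rfl, h | h⟩ | h | h
    · have := h.bounds; omega
    · have := h.bounds
      have := l.numLeaves_pos
      omega
    · exact ihl h
    · exact ihr h

theorem exists_subtreeAt_nodeLabel_iff {t : BinaryTree Unit} {a q : ℕ} :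
    (∃ l r b, SubtreeAt t a (node () l r) b ∧ q = IndexedForest.nodeLabel l b) ↔
      a ≤ q ∧ q + 1 < a + t.numLeaves := by
  induction t generalizing a with
  | nil =>
    simp only [subtreeAt_nil_iff, numLeaves_nil]
    constructor
    · rintro ⟨_, _, _, ⟨⟨⟩, _⟩, _⟩
    · omega
  | node _ l r ihl ihr =>
    have := l.numLeaves_pos
    have := r.numLeaves_pos
    rw [numLeaves_node]
    constructor
    · rintro ⟨l', r', b, h, rfl⟩
      rcases subtreeAt_node_iff.mp h with ⟨he, rfl⟩ | h | h
      · cases he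
        rw [IndexedForest.nodeLabel]
        omega
      · have := ihl.mp ⟨_, _, _, h, rfl⟩; omega
      · have := ihr.mp ⟨_, _, _, h, rfl⟩; omega
    · intro h
      rcases lt_trichotomy (q + 1) (a + l.numLeaves) with h' | h' | h'
      · obtain ⟨l', r', b, hs, hq⟩ := ihl.mpr ⟨h.1, h'⟩
        exact ⟨l', r', b, hs.of_left, hq⟩
      · exact ⟨l, r, a, .root, by rw [IndexedForest.nodeLabel]; omega⟩
      · obtain ⟨l', r', b, hs, hq⟩ := (ihr (a := a + l.numLeaves)).mpr (by omega)
        exact ⟨l', r', b, hs.of_right, hq⟩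

theorem labelEdge_iff {t : BinaryTree Unit} {a p q : ℕ} : LabelEdge t a p q ↔
    ∃ l r b, SubtreeAt t a (node () l r) b ∧ p = IndexedForest.nodeLabel l b ∧
      (RootLabel l b q ∨ RootLabel r (b + l.numLeaves) q) := by
  induction t generalizing a with
  | nil =>
    simp only [subtreeAt_nil_iff]
    constructor
    · exact False.elim
    · rintro ⟨_, _, _, ⟨⟨⟩, _⟩, _⟩
  | node _ l r ihl ihr =>
    rw [LabelEdge, ihl, ihr]
    constructor
    · rintro (⟨h, h'⟩ | ⟨l', r', b, h, h'⟩ | ⟨l', r', b, h, h'⟩)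
      · exact ⟨l, r, a, .root, h, h'⟩
      · exact ⟨l', r', b, h.of_left, h'⟩
      · exact ⟨l', r', b, h.of_right, h'⟩
    · rintro ⟨l', r', b, h, h'⟩
      rcases subtreeAt_node_iff.mp h with ⟨he, rfl⟩ | h | h
      · cases he
        exact .inl h'
      · exact .inr (.inl ⟨l', r', b, h, h'⟩)
      · exact .inr (.inr ⟨l', r', b, h, h'⟩)

theorem rootLabel_skip_of_le {t : BinaryTree Unit} {a i q : ℕ} (h : a + t.numLeaves ≤ i + 1) :
    RootLabel t a (skip i q) ↔ RootLabel t a q := by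
  unfold skip
  split_ifs
  · rfl
  · exact ⟨fun h => by have := h.bounds; omega, fun h => by have := h.bounds; omega⟩

theorem labelEdge_skip_of_le {t : BinaryTree Unit} {a i p q : ℕ}
    (h : a + t.numLeaves ≤ i + 1) :
    LabelEdge t a (skip i p) (skip i q) ↔ LabelEdge t a p q := by
  unfold skip
  split_ifs <;> first
    | rfl
    | exact ⟨fun h => by have := h.bounds; omega, fun h => by have := h.bounds; omega⟩

theorem rootLabel_add_one {t : BinaryTree Unit} {a q : ℕ} :
    RootLabel t (a + 1) (q + 1) ↔ RootLabel t a q := by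
  rcases t with _ | ⟨⟨⟩, l, r⟩
  · rfl
  · have := l.numLeaves_pos
    simp only [RootLabel]
    omega

theorem labelEdge_add_one {t : BinaryTree Unit} {a p q : ℕ} :
    LabelEdge t (a + 1) (p + 1) (q + 1) ↔ LabelEdge t a p q := by
  induction t generalizing a with
  | nil => rfl
  | node _ l r ihl ihr =>
    have := l.numLeaves_pos
    rw [LabelEdge, LabelEdge, ihl, Nat.add_right_comm, ihr, rootLabel_add_one, rootLabel_add_one]
    have label_add_one : p + 1 = a + l.numLeaves + 1 - 1 ↔ p = a + l.numLeaves - 1 := by omega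
    rw [label_add_one]

theorem rootLabel_skip_of_ge {t : BinaryTree Unit} {a i q : ℕ} (h : i ≤ a) :
    RootLabel t (a + 1) (skip i q) ↔ RootLabel t a q := by
  unfold skip
  split_ifs
  · exact ⟨fun h => by have := h.bounds; omega, fun h => by have := h.bounds; omega⟩
  · exact rootLabel_add_one

theorem labelEdge_skip_of_ge {t : BinaryTree Unit} {a i p q : ℕ} (h : i ≤ a) :
    LabelEdge t (a + 1) (skip i p) (skip i q) ↔ LabelEdge t a p q := by
  unfold skip
  split_ifs <;> first
    | exact labelEdge_add_one
    | exact ⟨fun h => by have := h.bounds; omega, fun h => by have := h.bounds; omega⟩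

namespace IsTrimOf

variable {t t' : BinaryTree Unit} {a i : ℕ}

theorem rootLabel_iff (h : IsTrimOf t a i t') {q : ℕ} :
    RootLabel t a (skip i q) ↔ RootLabel t' a q := by
  cases h with
  | here =>
    simp only [RootLabel, numLeaves_nil, Nat.add_sub_cancel, iff_false]
    exact skip_ne _ _
  | left h =>
    have := h.numLeaves_eq
    have := h.lt
    simp only [RootLabel, skip]
    split_ifs <;> omega
  | @right l r r' a i h =>
    have := h.le
    have := l.numLeaves_pos
    simp only [RootLabel, skip]
    split_ifs <;> omega

theorem labelEdge_iff (h : IsTrimOf t a i t') {p q : ℕ} :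
    LabelEdge t a (skip i p) (skip i q) ↔ LabelEdge t' a p q := by
  induction h with
  | here => simp [LabelEdge, RootLabel]
  | @left l l' r a i h ih =>
    have hll' := h.numLeaves_eq
    have := h.lt
    have label_skip : skip i p = a + l.numLeaves - 1 ↔ p = a + l'.numLeaves - 1 := by
      rw [skip]
      split_ifs <;> omega
    rw [LabelEdge, LabelEdge, ih, h.rootLabel_iff, label_skip, hll', ← Nat.add_assoc,
      rootLabel_skip_of_ge (by omega), labelEdge_skip_of_ge (by omega)]
  | @right l r r' a i h ih =>
    have := h.le
    have := l.numLeaves_pos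
    have label_skip : skip i p = a + l.numLeaves - 1 ↔ p = a + l.numLeaves - 1 := by
      rw [skip]
      split_ifs <;> omega
    rw [LabelEdge, LabelEdge, ih, h.rootLabel_iff, label_skip, rootLabel_skip_of_le (by omega),
      labelEdge_skip_of_le (by omega)]

theorem not_labelEdge (h : IsTrimOf t a i t') (q : ℕ) : ¬ LabelEdge t a i q := by
  induction h with
  | here => simp [LabelEdge, RootLabel]
  | @left l l' r a i h ih =>
    have := h.lt
    rintro (⟨_, _⟩ | h' | h')
    · omega
    · exact ih h'
    · have := h'.bounds; omega
  | @right l r r' a i h ih =>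
    have := h.le
    have := l.numLeaves_pos
    rintro (⟨_, _⟩ | h' | h')
    · omega
    · have := h'.bounds; omega
    · exact ih h'

end IsTrimOf

/-! ### Trimmed forests and their codes -/

namespace IndexedForest

variable {F G : IndexedForest} {i k₀ : ℕ}

theorem firstLeaf_succ (F : IndexedForest) (k : ℕ) :
    F.firstLeaf (k + 1) = F.firstLeaf k + (F.trees k).numLeaves :=
  Finset.sum_range_succ _ _

theorem firstLeaf_mono (F : IndexedForest) : Monotone F.firstLeaf :=
  monotone_nat_of_le_succ fun k => by rw [firstLeaf_succ]; omega

theorem firstLeaf_add_le (F : IndexedForest) {k k' : ℕ} (h : k < k') :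
    F.firstLeaf k + (F.trees k).numLeaves ≤ F.firstLeaf k' :=
  F.firstLeaf_succ k ▸ F.firstLeaf_mono h

theorem tree_index_unique {k k' b : ℕ} (h₁ : F.firstLeaf k ≤ b)
    (h₂ : b < F.firstLeaf k + (F.trees k).numLeaves) (h₃ : F.firstLeaf k' ≤ b)
    (h₄ : b < F.firstLeaf k' + (F.trees k').numLeaves) : k = k' := by
  by_contra hk
  rcases lt_or_gt_of_ne hk with hk | hk <;> have := F.firstLeaf_add_le hk <;> omega

/-- `F.TrimsAt G i k₀`: the forest `G` arises from `F` by deleting the terminal node with leftmost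
leaf `i`, which lies in the `k₀`-th tree. -/
structure TrimsAt (F G : IndexedForest) (i k₀ : ℕ) : Prop where
  isTrimOf : IsTrimOf (F.trees k₀) (F.firstLeaf k₀) i (G.trees k₀)
  trees_of_ne : ∀ k ≠ k₀, G.trees k = F.trees k

theorem trimsAt_trim (h : SubtreeAt (F.trees k₀) (F.firstLeaf k₀) (node () nil nil) i) :
    F.TrimsAt (F.trim i) i k₀ := by
  have ht := isTrimOf_trimTree h
  have h₁ := ht.le
  have h₂ := ht.lt
  have trees_self : (F.trim i).trees k₀ = trimTree (i - F.firstLeaf k₀) (F.trees k₀) :=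
    if_pos ⟨h₁, by rw [firstLeaf_succ]; omega⟩
  refine ⟨trees_self ▸ ht, fun k hk => if_neg ?_⟩
  rintro ⟨h₃, h₄⟩
  rw [firstLeaf_succ] at h₄
  exact hk (tree_index_unique h₃ h₄ h₁ (by omega))

theorem exists_trimsAt (h : i ∈ F.qdes) : ∃ k₀, F.TrimsAt (F.trim i) i k₀ :=
  h.imp fun _ => trimsAt_trim

namespace TrimsAt

theorem firstLeaf_of_le (h : F.TrimsAt G i k₀) {k : ℕ} (hk : k ≤ k₀) :
    G.firstLeaf k = F.firstLeaf k :=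
  Finset.sum_congr rfl fun j hj => by
    rw [h.trees_of_ne j ((Finset.mem_range.mp hj).trans_le hk).ne]

theorem firstLeaf_of_gt (h : F.TrimsAt G i k₀) {k : ℕ} (hk : k₀ < k) :
    F.firstLeaf k = G.firstLeaf k + 1 := by
  induction k, hk using Nat.le_induction with
  | base =>
    rw [Nat.succ_eq_add_one, firstLeaf_succ, firstLeaf_succ, h.firstLeaf_of_le le_rfl,
      h.isTrimOf.numLeaves_eq, Nat.add_assoc]
  | succ k hk ih =>
    rw [firstLeaf_succ, firstLeaf_succ, ih, h.trees_of_ne k (by omega), Nat.add_right_comm]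

theorem lt_of_lt (h : F.TrimsAt G i k₀) {k : ℕ} (hk : k < k₀) :
    F.firstLeaf k + (F.trees k).numLeaves ≤ i :=
  (F.firstLeaf_add_le hk).trans h.isTrimOf.le

theorem lt_of_gt (h : F.TrimsAt G i k₀) {k : ℕ} (hk : k₀ < k) : i < G.firstLeaf k := by
  have := h.isTrimOf.lt
  have := F.firstLeaf_add_le hk
  have := h.firstLeaf_of_gt hk
  omega

end TrimsAt

/-- The leftmost leaves of the subtrees of the internal nodes of a forest. -/
noncomputable def code (F : IndexedForest) : Multiset ℕ :=
  ∑ k ∈ F.finite_nontrivial.toFinset, codeAt (F.trees k) (F.firstLeaf k)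

theorem code_eq_sum {s : Finset ℕ} (h : F.finite_nontrivial.toFinset ⊆ s) :
    F.code = ∑ k ∈ s, codeAt (F.trees k) (F.firstLeaf k) := by
  refine Finset.sum_subset h fun k _ hk => ?_
  have trivial_tree : F.trees k = nil := by simpa using hk
  rw [trivial_tree, codeAt]

theorem mem_code {b : ℕ} : b ∈ F.code ↔ ∃ k, b ∈ codeAt (F.trees k) (F.firstLeaf k) := by
  rw [code, Multiset.mem_sum]
  refine ⟨fun ⟨k, _, h⟩ => ⟨k, h⟩, fun ⟨k, h⟩ => ⟨k, ?_, h⟩⟩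
  rw [Set.Finite.mem_toFinset]
  intro hk
  simp [hk, codeAt] at h

theorem code_eq_zero_iff : F.code = 0 ↔ F = empty := by
  constructor
  · intro h
    ext1
    funext k
    by_contra hk
    have := mem_code.mpr ⟨k, mem_codeAt_self_iff.mpr hk⟩
    simp [h] at this
  · rintro rfl
    simp [code, empty, codeAt]

theorem mem_qdes_iff : i ∈ F.qdes ↔ i ∈ codeQDes F.code := by
  rw [codeQDes, Set.mem_ofPred_eq, mem_code, mem_code]
  constructor
  · rintro ⟨k, hk⟩
    have h := (trimsAt_trim hk).isTrimOf
    rw [subtreeAt_terminal_iff] at hk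
    refine ⟨⟨k, hk.1⟩, ?_⟩
    rintro ⟨k', hk'⟩
    have bounds := bounds_of_mem_codeAt hk'
    obtain rfl := tree_index_unique (h.le.trans i.le_succ) h.lt bounds.1 (by omega)
    exact hk.2 hk'
  · rintro ⟨⟨k, hk⟩, h⟩
    exact ⟨k, subtreeAt_terminal_iff.mpr ⟨hk, fun h' => h ⟨k, h'⟩⟩⟩

theorem TrimsAt.code_eq (h : F.TrimsAt G i k₀) :
    F.code = i ::ₘ G.code.map (skip (i + 1)) := by
  classical
  set s := insert k₀ (F.finite_nontrivial.toFinset ∪ G.finite_nontrivial.toFinset)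
  have hk₀ : k₀ ∈ s := Finset.mem_insert_self _ _
  have hF : F.finite_nontrivial.toFinset ⊆ s :=
    Finset.subset_union_left.trans (Finset.subset_insert _ _)
  have hG : G.finite_nontrivial.toFinset ⊆ s :=
    Finset.subset_union_right.trans (Finset.subset_insert _ _)
  rw [code_eq_sum hF, code_eq_sum hG, ← Finset.add_sum_erase _ _ hk₀,
    ← Finset.add_sum_erase _ _ hk₀, Multiset.map_add, ← Multiset.cons_add,
    h.firstLeaf_of_le le_rfl, ← h.isTrimOf.codeAt_eq,
    ← Multiset.coe_mapAddMonoidHom (skip (i + 1)), map_sum]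
  congr 1
  refine Finset.sum_congr rfl fun k hk => ?_
  rw [Multiset.coe_mapAddMonoidHom, h.trees_of_ne k (Finset.ne_of_mem_erase hk)]
  rcases lt_or_gt_of_ne (Finset.ne_of_mem_erase hk) with hk | hk
  · have := h.lt_of_lt hk
    rw [h.firstLeaf_of_le hk.le, map_skip_codeAt_of_le (by omega)]
  · rw [h.firstLeaf_of_gt hk, map_skip_codeAt_of_ge (h.lt_of_gt hk)]

theorem TrimsAt.code_eq_trimCode (h : F.TrimsAt G i k₀) : G.code = trimCode F.code i := by
  rw [h.code_eq, trimCode, Multiset.erase_cons_head, Multiset.map_map]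
  conv_lhs => rw [← Multiset.map_id G.code]
  refine Multiset.map_congr rfl fun b _ => ?_
  simp only [Function.comp_apply, collapse, skip, id]
  split_ifs <;> omega

end IndexedForest

theorem isDoubleForestFamily_codePoly : IsDoubleForestFamily fun F => codePoly F.code where
  homogeneous F := ⟨_, (isTrimmingPrimitive_codePoly F.code).homogeneous⟩
  normalized F := by
    rw [(isTrimmingPrimitive_codePoly F.code).normalized]
    classical
    exact if_congr IndexedForest.code_eq_zero_iff rfl rfl
  trimming F i := by
    rw [eqTrim_eq_trimAt, (isTrimmingPrimitive_codePoly F.code).trimming]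
    split_ifs with hi
    · obtain ⟨_, h⟩ := IndexedForest.exists_trimsAt hi
      rw [codeTrimming_of_mem (IndexedForest.mem_qdes_iff.mp hi), h.code_eq_trimCode]
    · exact codeTrimming_of_notMem (IndexedForest.mem_qdes_iff.not.mp hi)

theorem isDoubleForestFamily_doubleForestPoly : IsDoubleForestFamily doubleForestPoly :=
  Classical.epsilon_spec ⟨_, isDoubleForestFamily_codePoly⟩

/-! ### Sylvester words -/

theorem forall_iff_forall_skip {P : ℕ → Prop} (i : ℕ) :
    (∀ q, P q) ↔ P i ∧ ∀ q, P (skip i q) := by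
  refine ⟨fun h => ⟨h i, fun q => h _⟩, fun h q => ?_⟩
  rcases eq_or_ne q i with rfl | hq
  · exact h.1
  · obtain ⟨q, rfl⟩ := exists_skip_eq hq
    exact h.2 q

theorem forall_idxOf_lt_iff_pairwise {α : Type*} [BEq α] [LawfulBEq α] {r : α → α → Prop}
    [Std.Irrefl r] {w : List α} (hw : w.Nodup) :
    (∀ p ∈ w, ∀ q ∈ w, r p q → w.idxOf p < w.idxOf q) ↔ w.Pairwise fun p q => ¬ r q p := by
  rw [List.pairwise_iff_getElem]
  refine ⟨fun h m n hm hn hmn hr => ?_, fun h p hp q hq hr => ?_⟩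
  · have := h _ (List.getElem_mem hn) _ (List.getElem_mem hm) hr
    rw [hw.idxOf_getElem n hn, hw.idxOf_getElem m hm] at this
    omega
  · obtain ⟨m, hm, rfl⟩ := List.getElem_of_mem hp
    obtain ⟨n, hn, rfl⟩ := List.getElem_of_mem hq
    rw [hw.idxOf_getElem m hm, hw.idxOf_getElem n hn]
    rcases lt_trichotomy m n with hmn | rfl | hnm
    · exact hmn
    · exact absurd hr (irrefl _)
    · exact absurd hr (h n m hn hm hnm)

namespace IndexedForest

variable {F G : IndexedForest} {i k₀ : ℕ}

/-- The leaf `q` is a canonical label of the forest, or equivalently, it is not the last leaf of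
its tree. -/
def HasLabel (F : IndexedForest) (q : ℕ) : Prop :=
  ∃ k, F.firstLeaf k ≤ q ∧ q + 1 < F.firstLeaf k + (F.trees k).numLeaves

/-- `p` and `q` are the canonical labels of an internal node and of one of its children. -/
def HasEdge (F : IndexedForest) (p q : ℕ) : Prop :=
  ∃ k, LabelEdge (F.trees k) (F.firstLeaf k) p q

theorem HasEdge.hasLabel_left {p q : ℕ} (h : F.HasEdge p q) : F.HasLabel p :=
  h.imp fun _ h => h.bounds.1

theorem HasEdge.hasLabel_right {p q : ℕ} (h : F.HasEdge p q) : F.HasLabel q :=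
  h.imp fun _ h => h.bounds.2

instance : Std.Irrefl F.HasEdge := ⟨fun _ ⟨_, h⟩ => h.ne rfl⟩

theorem hasLabel_iff {q : ℕ} : F.HasLabel q ↔
    ∃ l r b, F.HasSubtree (node () l r) b ∧ q = nodeLabel l b := by
  constructor
  · rintro ⟨k, h⟩
    obtain ⟨l, r, b, h, h'⟩ := exists_subtreeAt_nodeLabel_iff.mpr h
    exact ⟨l, r, b, ⟨k, h⟩, h'⟩
  · rintro ⟨l, r, b, ⟨k, h⟩, h'⟩
    exact ⟨k, exists_subtreeAt_nodeLabel_iff.mp ⟨l, r, b, h, h'⟩⟩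

theorem forall_hasEdge_iff {P : ℕ → ℕ → Prop} : (∀ p q, F.HasEdge p q → P p q) ↔
    (∀ l₁ l₂ r b, F.HasSubtree (node () (node () l₁ l₂) r) b →
      P (nodeLabel (node () l₁ l₂) b) (nodeLabel l₁ b)) ∧
    ∀ l r₁ r₂ b, F.HasSubtree (node () l (node () r₁ r₂)) b →
      P (nodeLabel l b) (nodeLabel r₁ (b + l.numLeaves)) := by
  refine ⟨fun h => ⟨fun l₁ l₂ r b ⟨k, hs⟩ => ?_, fun l r₁ r₂ b ⟨k, hs⟩ => ?_⟩, ?_⟩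
  · exact h _ _ ⟨k, labelEdge_iff.mpr ⟨_, _, _, hs, rfl, .inl rfl⟩⟩
  · exact h _ _ ⟨k, labelEdge_iff.mpr ⟨_, _, _, hs, rfl, .inr rfl⟩⟩
  · rintro ⟨hl, hr⟩ p q ⟨k, h⟩
    obtain ⟨l, r, b, hs, rfl, hq | hq⟩ := labelEdge_iff.mp h
    · rcases l with _ | ⟨⟨⟩, l₁, l₂⟩
      · exact hq.elim
      · exact hq ▸ hl l₁ l₂ r b ⟨k, hs⟩
    · rcases r with _ | ⟨⟨⟩, r₁, r₂⟩
      · exact hq.elim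
      · exact hq ▸ hr l r₁ r₂ b ⟨k, hs⟩

theorem isSylvester_iff {w : List ℕ} : F.IsSylvester w ↔
    w.Nodup ∧ (∀ q, q ∈ w ↔ F.HasLabel q) ∧ w.Pairwise fun p q => ¬ F.HasEdge q p := by
  have edges_iff (hn : w.Nodup) (hm : ∀ q, q ∈ w ↔ F.HasLabel q) :
      (∀ p q, F.HasEdge p q → w.idxOf p < w.idxOf q) ↔
        w.Pairwise fun p q => ¬ F.HasEdge q p := by
    rw [← forall_idxOf_lt_iff_pairwise hn]
    exact ⟨fun h p _ q _ => h p q, fun h p q he =>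
      h p ((hm p).mpr he.hasLabel_left) q ((hm q).mpr he.hasLabel_right) he⟩
  constructor
  · intro h
    have hm (q : ℕ) : q ∈ w ↔ F.HasLabel q := by rw [h.mem_iff, hasLabel_iff]
    exact ⟨h.nodup, hm, (edges_iff h.nodup hm).mp
      (forall_hasEdge_iff.mpr ⟨h.before_left, h.before_right⟩)⟩
  · rintro ⟨hn, hm, hp⟩
    have hedge := forall_hasEdge_iff.mp ((edges_iff hn hm).mpr hp)
    exact ⟨hn, fun q => by rw [hm, hasLabel_iff], hedge.1, hedge.2⟩

namespace TrimsAt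

theorem hasEdge_skip_iff (h : F.TrimsAt G i k₀) {p q : ℕ} :
    F.HasEdge (skip i p) (skip i q) ↔ G.HasEdge p q := by
  refine exists_congr fun k => ?_
  rcases lt_trichotomy k k₀ with hk | rfl | hk
  · rw [h.firstLeaf_of_le hk.le, h.trees_of_ne k hk.ne,
      labelEdge_skip_of_le ((h.lt_of_lt hk).trans i.le_succ)]
  · rw [h.firstLeaf_of_le le_rfl, h.isTrimOf.labelEdge_iff]
  · rw [h.firstLeaf_of_gt hk, h.trees_of_ne k hk.ne', labelEdge_skip_of_ge (h.lt_of_gt hk).le]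

theorem hasLabel_skip_iff (h : F.TrimsAt G i k₀) {q : ℕ} :
    F.HasLabel (skip i q) ↔ G.HasLabel q := by
  refine exists_congr fun k => ?_
  rcases lt_trichotomy k k₀ with hk | rfl | hk
  · have := h.lt_of_lt hk
    rw [h.firstLeaf_of_le hk.le, h.trees_of_ne k hk.ne, skip]
    split_ifs <;> omega
  · have := h.isTrimOf.le
    have := h.isTrimOf.lt
    have := h.isTrimOf.numLeaves_eq
    rw [h.firstLeaf_of_le le_rfl, skip]
    split_ifs <;> omega
  · have := h.lt_of_gt hk
    rw [h.firstLeaf_of_gt hk, h.trees_of_ne k hk.ne', skip]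
    split_ifs <;> omega

theorem hasLabel (h : F.TrimsAt G i k₀) : F.HasLabel i := ⟨k₀, h.isTrimOf.le, h.isTrimOf.lt⟩

theorem not_hasEdge (h : F.TrimsAt G i k₀) (q : ℕ) : ¬ F.HasEdge i q := by
  rintro ⟨k, he⟩
  have bounds := he.bounds.1
  have := h.isTrimOf.lt
  obtain rfl := tree_index_unique h.isTrimOf.le (by omega) bounds.1 (by omega)
  exact h.isTrimOf.not_labelEdge q he

theorem isSylvester_map_skip_append_iff (h : F.TrimsAt G i k₀) {w : List ℕ} :
    F.IsSylvester (w.map (skip i) ++ [i]) ↔ G.IsSylvester w := by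
  rw [isSylvester_iff, isSylvester_iff]
  refine and_congr ?_ (and_congr ?_ ?_)
  · simp [List.nodup_append, List.nodup_map_iff (skip_injective i), skip_ne]
  · rw [forall_iff_forall_skip i]
    simp [h.hasLabel, h.hasLabel_skip_iff, skip_ne, (skip_injective i).eq_iff]
  · simp [List.pairwise_append, List.pairwise_map, h.hasEdge_skip_iff, h.not_hasEdge]

end TrimsAt

theorem mem_qdes_of_not_hasEdge (h : F.HasLabel i) (h' : ∀ q, ¬ F.HasEdge i q) : i ∈ F.qdes := by
  obtain ⟨l, r, b, ⟨k, hs⟩, rfl⟩ := hasLabel_iff.mp h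
  rcases l with _ | ⟨⟨⟩, l₁, l₂⟩
  · rcases r with _ | ⟨⟨⟩, r₁, r₂⟩
    · exact ⟨k, by simpa [nodeLabel] using hs⟩
    · exact absurd ⟨k, labelEdge_iff.mpr ⟨_, _, _, hs, rfl, .inr rfl⟩⟩ (h' _)
  · exact absurd ⟨k, labelEdge_iff.mpr ⟨_, _, _, hs, rfl, .inl rfl⟩⟩ (h' _)

theorem isSylvester_nil_iff : F.IsSylvester [] ↔ F = empty := by
  have hasLabel_iff_ne_nil : (∃ q, F.HasLabel q) ↔ ∃ k, F.trees k ≠ nil := by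
    constructor
    · rintro ⟨q, k, hq⟩
      refine ⟨k, fun hk => ?_⟩
      rw [hk, numLeaves_nil] at hq
      omega
    · rintro ⟨k, hk⟩
      exact ⟨_, k, bounds_of_mem_codeAt (mem_codeAt_self_iff.mpr hk)⟩
  rw [isSylvester_iff, IndexedForest.ext_iff, funext_iff]
  simpa [empty, not_exists] using hasLabel_iff_ne_nil.not

theorem IsSylvester.mem_qdes {w : List ℕ} (h : F.IsSylvester (w ++ [i])) : i ∈ F.qdes := by
  obtain ⟨-, mem_iff, pairwise⟩ := isSylvester_iff.mp h
  refine mem_qdes_of_not_hasEdge ((mem_iff i).mp (by simp)) fun q he => ?_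
  rcases List.mem_append.mp ((mem_iff q).mpr he.hasLabel_right) with hq | hq
  · exact (List.pairwise_append.mp pairwise).2.2 q hq i (List.mem_singleton_self i) he
  · rw [List.mem_singleton.mp hq] at he
    exact irrefl i he

theorem isSylvester_append_singleton_iff (h : i ∈ F.qdes) {w : List ℕ} :
    F.IsSylvester (w ++ [i]) ↔ ∃ w', w'.map (skip i) = w ∧ (F.trim i).IsSylvester w' := by
  obtain ⟨k₀, ht⟩ := exists_trimsAt h
  refine ⟨fun hw => ?_, ?_⟩
  · have hiw : i ∉ w := fun hi => by simpa using (List.nodup_append.mp hw.nodup).2.2 i hi i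
    obtain ⟨w', rfl⟩ : w ∈ Set.range (List.map (skip i)) := by
      rw [Set.range_list_map]
      exact fun j hj => exists_skip_eq (ne_of_mem_of_not_mem hj hiw)
    exact ⟨w', rfl, ht.isSylvester_map_skip_append_iff.mp hw⟩
  · rintro ⟨w', rfl, hw⟩
    exact ht.isSylvester_map_skip_append_iff.mpr hw

end IndexedForest

/-! ### Sums over subwords -/

theorem sort_insert_of_lt {α : Type*} [LinearOrder α] {s : Finset α} {b : α}
    (h : ∀ a ∈ s, a < b) : (insert b s).sort (· ≤ ·) = s.sort (· ≤ ·) ++ [b] := by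
  have hlt (a : α) (ha : a ∈ s.sort (· ≤ ·)) : a < b := h a ((Finset.mem_sort _).mp ha)
  have nodup : (s.sort (· ≤ ·) ++ [b]).Nodup :=
    List.concat_eq_append ▸ (Finset.sort_nodup s _).concat fun hb => (hlt b hb).false
  have toFinset_eq : (s.sort (· ≤ ·) ++ [b]).toFinset = insert b s := by
    ext x
    simp
  rw [← toFinset_eq, List.toFinset_sort (· ≤ ·) nodup, List.pairwise_append]
  exact ⟨Finset.pairwise_sort s _, List.pairwise_singleton _ _,
    fun a ha b' hb' => List.mem_singleton.mp hb' ▸ (hlt a ha).le⟩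

theorem sum_finset_eq_of_univ_eq_insert {α β M : Type*} [Fintype α] [Fintype β] [DecidableEq β]
    [AddCommMonoid M] {e : α ↪ β} {b : β} (hb : b ∉ Finset.univ.map e)
    (h : Finset.univ = insert b (Finset.univ.map e)) (f : Finset β → M) :
    ∑ T, f T = ∑ S : Finset α, f (S.map e) + ∑ S : Finset α, f (insert b (S.map e)) := by
  have powerset_map : (Finset.univ.map e).powerset =
      Finset.univ.map (Finset.mapEmbedding e).toEmbedding := by
    ext T
    simp [Finset.subset_map_iff, eq_comm]
  rw [← Finset.powerset_univ, h, Finset.sum_powerset_insert hb, powerset_map, Finset.sum_map,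
    Finset.sum_map]
  rfl

/-- The positions of `ω`, as positions of `ω ++ ω'`. -/
def prefixPos (ω ω' : List ℕ) : Fin ω.length ↪o Fin (ω ++ ω').length :=
  Fin.castLEOrderEmb (by simp)

/-- The last position of `ω ++ [i]`. -/
def lastPos (ω : List ℕ) (i : ℕ) : Fin (ω ++ [i]).length := ⟨ω.length, by simp⟩

theorem prefixPos_lt_lastPos {ω : List ℕ} {i : ℕ} (p : Fin ω.length) :
    prefixPos ω [i] p < lastPos ω i := p.2

theorem get_prefixPos {ω ω' : List ℕ} (p : Fin ω.length) :
    (ω ++ ω').get (prefixPos ω ω' p) = ω.get p :=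
  List.getElem_append_left p.2

theorem get_lastPos {ω : List ℕ} {i : ℕ} : (ω ++ [i]).get (lastPos ω i) = i :=
  List.getElem_concat_length rfl _

theorem lastPos_notMem_map (ω : List ℕ) (i : ℕ) (S : Finset (Fin ω.length)) :
    lastPos ω i ∉ S.map (prefixPos ω [i]).toEmbedding := by
  rw [Finset.mem_map]
  rintro ⟨p, -, hp⟩
  exact (prefixPos_lt_lastPos p).ne hp

theorem univ_eq_insert_lastPos (ω : List ℕ) (i : ℕ) :
    (Finset.univ : Finset (Fin (ω ++ [i]).length)) =
      insert (lastPos ω i) (Finset.univ.map (prefixPos ω [i]).toEmbedding) := by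
  ext ⟨p, hp⟩
  rw [List.length_append, List.length_singleton] at hp
  simp only [Finset.mem_univ, Finset.mem_insert, Finset.mem_map, true_and, true_iff]
  rcases Nat.lt_succ_iff_lt_or_eq.mp hp with hp | rfl
  · exact .inr ⟨⟨p, hp⟩, rfl⟩
  · exact .inl rfl

theorem subwordAt_map_prefixPos {ω ω' : List ℕ} (S : Finset (Fin ω.length)) :
    subwordAt (ω ++ ω') (S.map (prefixPos ω ω').toEmbedding) = subwordAt ω S := by
  have sort_eq := Finset.map_sort (prefixPos ω ω').toEmbedding S (· ≤ ·) (· ≤ ·)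
    fun _ _ _ _ => (prefixPos ω ω').le_iff_le.symm
  rw [subwordAt, ← sort_eq, List.map_map]
  exact List.map_congr_left fun p _ => get_prefixPos p

theorem subwordAt_insert_lastPos {ω : List ℕ} {i : ℕ} (S : Finset (Fin ω.length)) :
    subwordAt (ω ++ [i]) (insert (lastPos ω i) (S.map (prefixPos ω [i]).toEmbedding)) =
      subwordAt ω S ++ [i] := by
  have hlt : ∀ p ∈ S.map (prefixPos ω [i]).toEmbedding, p < lastPos ω i := by
    simpa using fun p _ => prefixPos_lt_lastPos p
  rw [subwordAt, sort_insert_of_lt hlt, List.map_append, List.map_singleton, get_lastPos,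
    ← subwordAt, subwordAt_map_prefixPos]

theorem wordPerm_append_singleton (ω : List ℕ) (i : ℕ) :
    wordPerm (ω ++ [i]) = wordPerm ω * simpleTransposition i := by
  simp [wordPerm]

noncomputable section

theorem subwordWeight_map_prefixPos {ω ω' : List ℕ} (S : Finset (Fin ω.length)) :
    subwordWeight (ω ++ ω') (S.map (prefixPos ω ω').toEmbedding) = subwordWeight ω S := by
  rw [subwordWeight, Finset.prod_map]
  refine Finset.prod_congr rfl fun p _ => ?_
  have take_eq : (ω ++ ω').take (prefixPos ω ω' p) = ω.take p :=
    List.take_append_of_le_length p.2.le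
  rw [RelEmbedding.coe_toEmbedding, get_prefixPos, take_eq]

theorem subwordWeight_insert_lastPos {ω : List ℕ} {i : ℕ} (S : Finset (Fin ω.length)) :
    subwordWeight (ω ++ [i]) (insert (lastPos ω i) (S.map (prefixPos ω [i]).toEmbedding)) =
      (X (wordPerm ω (i + 1)) - X (wordPerm ω i)) * subwordWeight ω S := by
  have take_eq : (ω ++ [i]).take (lastPos ω i) = ω := List.take_left
  rw [subwordWeight, Finset.prod_insert (lastPos_notMem_map ω i S), get_lastPos, take_eq,
    ← subwordWeight, subwordWeight_map_prefixPos]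

open Classical in
/-- The sum of the weights of the subwords of `ω` (as sets of positions) that satisfy `Φ`. -/
def subwordSum (ω : List ℕ) (Φ : List ℕ → Prop) : PolT :=
  ∑ S : Finset (Fin ω.length), if Φ (subwordAt ω S) then subwordWeight ω S else 0

theorem sum_sylvesterSubwords (ω : List ℕ) (F : IndexedForest) :
    ∑ S ∈ sylvesterSubwords ω F, subwordWeight ω S = subwordSum ω F.IsSylvester := by
  rw [sylvesterSubwords, Finset.sum_filter, subwordSum]

theorem subwordSum_nil (Φ : List ℕ → Prop) [Decidable (Φ [])] :
    subwordSum [] Φ = if Φ [] then 1 else 0 := by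
  have : IsEmpty (Fin ([] : List ℕ).length) := Fin.isEmpty
  rw [subwordSum, Fintype.sum_eq_single ∅ fun S hS => absurd S.eq_empty_of_isEmpty hS]
  simp [subwordAt, subwordWeight]

theorem subwordSum_eq_zero (ω : List ℕ) {Φ : List ℕ → Prop} (h : ∀ w, ¬ Φ w) :
    subwordSum ω Φ = 0 := by
  simp [subwordSum, h]

theorem subwordSum_append_singleton (ω : List ℕ) (i : ℕ) (Φ : List ℕ → Prop) :
    subwordSum (ω ++ [i]) Φ = subwordSum ω Φ +
      (X (wordPerm ω (i + 1)) - X (wordPerm ω i)) * subwordSum ω fun w => Φ (w ++ [i]) := by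
  rw [subwordSum, sum_finset_eq_of_univ_eq_insert (lastPos_notMem_map ω i _)
    (univ_eq_insert_lastPos ω i)]
  simp only [subwordSum, Finset.mul_sum, mul_ite, mul_zero]
  refine congrArg₂ _ (Finset.sum_congr rfl fun S _ => ?_) (Finset.sum_congr rfl fun S _ => ?_)
  · rw [subwordAt_map_prefixPos, subwordWeight_map_prefixPos]
  · rw [subwordAt_insert_lastPos, subwordWeight_insert_lastPos]

end

/-! ### Admissible words -/

section

variable {i j a : ℕ}

theorem simpleTransposition_left : simpleTransposition i i = i + 1 :=
  Equiv.swap_apply_left _ _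

theorem simpleTransposition_right : simpleTransposition i (i + 1) = i :=
  Equiv.swap_apply_right _ _

theorem simpleTransposition_of_ne (h : a ≠ i) (h' : a ≠ i + 1) : simpleTransposition i a = a :=
  Equiv.swap_apply_of_ne_of_ne h h'

theorem simpleTransposition_mul_self :
    simpleTransposition i * simpleTransposition i = 1 :=
  Equiv.swap_mul_self _ _

theorem simpleTransposition_skip : simpleTransposition i (skip i a) = skip (i + 1) a := by
  simp only [simpleTransposition, skip, Equiv.swap_apply_def]
  split_ifs <;> omega

theorem simpleTransposition_skip_succ : simpleTransposition i (skip (i + 1) a) = skip i a := by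
  rw [← simpleTransposition_skip, ← Equiv.Perm.mul_apply, simpleTransposition_mul_self,
    Equiv.Perm.one_apply]

end

/-- Right multiplication of `σ` by `s_i` removes the non-minimal element `i` from the cycle of
`i + 1`, or adds the fixed point `i` to the cycle of `i + 1` as its new minimum. -/
def IsAdmissibleStep (σ : Equiv.Perm ℕ) (i : ℕ) : Prop :=
  (σ i = i ∧ i < σ (i + 1)) ∨ (σ (i + 1) = i ∧ σ i < i)

/-- A word all of whose letters are admissible steps from the product of the preceding ones.  This
is the part of being a noncrossing reduced word on which the induction over words rests. -/
def IsAdmissibleWord (ω : List ℕ) : Prop :=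
  ∀ ω₁ j, ω₁ ++ [j] <+: ω → IsAdmissibleStep (wordPerm ω₁) j

/-- The value `i` is taken by `σ` at the position `i` or `i + 1`, so that deleting this value and
its position from `σ` gives a permutation. -/
def AlmostFixes (σ : Equiv.Perm ℕ) (i : ℕ) : Prop := σ i = i ∨ σ (i + 1) = i

theorem isAdmissibleWord_nil : IsAdmissibleWord [] :=
  fun _ _ h => absurd (List.prefix_nil.mp h) (List.append_ne_nil_of_right_ne_nil _ (by simp))

theorem isAdmissibleWord_append_singleton {ω : List ℕ} {i : ℕ} :
    IsAdmissibleWord (ω ++ [i]) ↔ IsAdmissibleWord ω ∧ IsAdmissibleStep (wordPerm ω) i := by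
  refine ⟨fun h => ⟨fun ω₁ j h' => h ω₁ j (h'.trans (List.prefix_append _ _)),
    h ω i List.prefix_rfl⟩, ?_⟩
  rintro ⟨h, h'⟩ ω₁ j hp
  rcases List.prefix_concat_iff.mp hp with e | hp
  · obtain ⟨rfl, rfl⟩ := List.append_singleton_inj.mp e
    exact h'
  · exact h ω₁ j hp

theorem IsAdmissibleStep.almostFixes {σ : Equiv.Perm ℕ} {i : ℕ} (h : IsAdmissibleStep σ i) :
    AlmostFixes σ i :=
  h.imp And.left And.left

theorem IsAdmissibleStep.almostFixes_of_mul {σ : Equiv.Perm ℕ} {i j : ℕ}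
    (h : IsAdmissibleStep σ j) (h' : AlmostFixes (σ * simpleTransposition j) i) :
    AlmostFixes σ i := by
  simp only [AlmostFixes, Equiv.Perm.mul_apply] at h' ⊢
  rcases h' with h' | h'
  · rcases eq_or_ne i j with rfl | hj
    · exact .inr (by rwa [simpleTransposition_left] at h')
    rcases eq_or_ne i (j + 1) with rfl | hj'
    · rw [simpleTransposition_right] at h'
      rcases h with h | h <;> omega
    · exact .inl (by rwa [simpleTransposition_of_ne hj hj'] at h')
  · rcases eq_or_ne (i + 1) j with rfl | hj
    · rw [simpleTransposition_left] at h'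
      rcases h with h | h <;> omega
    rcases eq_or_ne i j with rfl | hj'
    · exact .inl (by rwa [simpleTransposition_right] at h')
    · exact .inr (by rwa [simpleTransposition_of_ne hj (by omega)] at h')

/-! ### Deleting a letter -/

theorem skip_lt_skip {i a b : ℕ} : skip i a < skip i b ↔ a < b := by
  unfold skip
  split_ifs <;> omega

theorem collapse_skip (i j : ℕ) : collapse i (skip i j) = j := by
  unfold collapse skip
  split_ifs <;> omega

/-- `τ` arises from `σ` by deleting the value `i` and its position `p`, which is `i`
or `i + 1`. -/
structure IsDeletion (i p : ℕ) (τ σ : Equiv.Perm ℕ) : Prop where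
  pos : p = i ∨ p = i + 1
  apply_pos : σ p = i
  apply_skip : ∀ a, σ (skip p a) = skip i (τ a)

namespace IsDeletion

variable {i p j : ℕ} {τ σ : Equiv.Perm ℕ}

theorem one (i : ℕ) : IsDeletion i i 1 1 := ⟨.inl rfl, rfl, fun _ => rfl⟩

theorem mul_self (h : IsDeletion i p τ σ) :
    IsDeletion i (simpleTransposition i p) τ (σ * simpleTransposition i) := by
  refine ⟨?_, ?_, fun a => ?_⟩
  · rcases h.pos with rfl | rfl
    exacts [.inr simpleTransposition_left, .inl simpleTransposition_right]
  · rw [← Equiv.Perm.mul_apply, mul_assoc, simpleTransposition_mul_self, mul_one, h.apply_pos]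
  · rw [Equiv.Perm.mul_apply, ← h.apply_skip]
    rcases h.pos with rfl | rfl
    · rw [simpleTransposition_left, simpleTransposition_skip_succ]
    · rw [simpleTransposition_right, simpleTransposition_skip]

theorem skip_pos (h : IsDeletion i p τ σ)
    (h' : AlmostFixes (σ * simpleTransposition (skip i j)) i) :
    skip p j = skip i j ∧ skip p (j + 1) = skip i j + 1 := by
  have eq_or_eq (q : ℕ) (hq : σ (simpleTransposition (skip i j) q) = i) : q = i ∨ q = i + 1 :=
    h'.imp (fun e => (σ * simpleTransposition (skip i j)).injective (hq.trans e.symm))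
      fun e => (σ * simpleTransposition (skip i j)).injective (hq.trans e.symm)
  have ne_skip := skip_ne i j
  have pos_ne : p ≠ skip i j := fun hp => by
    have := eq_or_eq (p + 1) (by rw [hp, simpleTransposition_right, ← hp, h.apply_pos])
    have := h.pos
    omega
  have pos_ne_succ : p ≠ skip i j + 1 := fun hp => by
    have := eq_or_eq (skip i j) (by rw [simpleTransposition_left, ← hp, h.apply_pos])
    have := h.pos
    omega
  rcases h.pos with rfl | rfl <;> unfold skip at * <;> split_ifs at * <;> omega

theorem mul_skip (h : IsDeletion i p τ σ)
    (h' : AlmostFixes (σ * simpleTransposition (skip i j)) i) :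
    IsDeletion i p (τ * simpleTransposition j) (σ * simpleTransposition (skip i j)) := by
  obtain ⟨skip_j, skip_succ⟩ := h.skip_pos h'
  refine ⟨h.pos, ?_, fun a => ?_⟩
  · rw [Equiv.Perm.mul_apply, simpleTransposition_of_ne, h.apply_pos]
    exacts [skip_j ▸ (skip_ne p j).symm, skip_succ ▸ (skip_ne p (j + 1)).symm]
  · rw [Equiv.Perm.mul_apply, Equiv.Perm.mul_apply, ← h.apply_skip, EmbeddingLike.apply_eq_iff_eq]
    rcases eq_or_ne a j with rfl | hj
    · rw [skip_j, simpleTransposition_left, simpleTransposition_left, skip_succ]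
    rcases eq_or_ne a (j + 1) with rfl | hj'
    · rw [skip_succ, simpleTransposition_right, simpleTransposition_right, skip_j]
    · rw [simpleTransposition_of_ne hj hj', simpleTransposition_of_ne]
      exacts [skip_j ▸ (skip_injective p).ne hj, skip_succ ▸ (skip_injective p).ne hj']

theorem isAdmissibleStep (h : IsDeletion i p τ σ)
    (h' : AlmostFixes (σ * simpleTransposition (skip i j)) i)
    (hσ : IsAdmissibleStep σ (skip i j)) : IsAdmissibleStep τ j := by
  obtain ⟨skip_j, skip_succ⟩ := h.skip_pos h'
  rwa [IsAdmissibleStep, ← skip_succ, ← skip_j, h.apply_skip, h.apply_skip, skip_j, skip_lt_skip,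
    skip_lt_skip, (skip_injective i).eq_iff, (skip_injective i).eq_iff] at hσ

end IsDeletion

/-- Delete all occurrences of the letter `i` and lower the larger letters by one. -/
def deleteLetter (i : ℕ) (ω : List ℕ) : List ℕ :=
  (ω.filter (· ≠ i)).map (collapse i)

theorem deleteLetter_append_self (i : ℕ) (ω : List ℕ) :
    deleteLetter i (ω ++ [i]) = deleteLetter i ω := by
  simp [deleteLetter]

theorem deleteLetter_append_skip (i j : ℕ) (ω : List ℕ) :
    deleteLetter i (ω ++ [skip i j]) = deleteLetter i ω ++ [j] := by
  simp [deleteLetter, skip_ne, collapse_skip]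

theorem length_deleteLetter_le (i : ℕ) (ω : List ℕ) : (deleteLetter i ω).length ≤ ω.length := by
  rw [deleteLetter, List.length_map]
  exact List.length_filter_le _ _

theorem exists_map_eq_append_singleton_iff {α β : Type*} {f : α → β} (hf : f.Injective)
    {w : List β} {a : α} {Φ : List α → Prop} :
    (∃ w', w'.map f = w ++ [f a] ∧ Φ w') ↔ ∃ w', w'.map f = w ∧ Φ (w' ++ [a]) := by
  constructor
  · rintro ⟨_, h, hΦ⟩
    obtain ⟨w', v, rfl, rfl, hv⟩ := List.map_eq_append_iff.mp h
    obtain ⟨b, rfl, hb⟩ := List.map_eq_singleton_iff.mp hv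
    exact ⟨w', rfl, hf hb ▸ hΦ⟩
  · rintro ⟨w', rfl, hΦ⟩
    exact ⟨w' ++ [a], List.map_append, hΦ⟩

theorem map_skip_ne_append_singleton (i : ℕ) (w w' : List ℕ) : w'.map (skip i) ≠ w ++ [i] := by
  intro h
  obtain ⟨a, -, ha⟩ := List.mem_map.mp (h ▸ List.mem_concat_self)
  exact skip_ne i a ha

namespace IsAdmissibleWord

variable {ω : List ℕ} {i : ℕ}

theorem exists_isDeletion (hω : IsAdmissibleWord ω) (hi : AlmostFixes (wordPerm ω) i) :
    ∃ p, IsDeletion i p (wordPerm (deleteLetter i ω)) (wordPerm ω) := by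
  induction ω using List.reverseRecOn with
  | nil => exact ⟨i, IsDeletion.one i⟩
  | append_singleton ω j ih =>
    rw [isAdmissibleWord_append_singleton] at hω
    rw [wordPerm_append_singleton] at hi
    obtain ⟨p, hp⟩ := ih hω.1 (hω.2.almostFixes_of_mul hi)
    rw [wordPerm_append_singleton]
    rcases eq_or_ne j i with rfl | hj
    · rw [deleteLetter_append_self]
      exact ⟨_, hp.mul_self⟩
    · obtain ⟨j, rfl⟩ := exists_skip_eq hj
      rw [deleteLetter_append_skip, wordPerm_append_singleton]
      exact ⟨p, hp.mul_skip hi⟩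

theorem isAdmissibleWord_deleteLetter (hω : IsAdmissibleWord ω)
    (hi : AlmostFixes (wordPerm ω) i) : IsAdmissibleWord (deleteLetter i ω) := by
  induction ω using List.reverseRecOn with
  | nil => exact isAdmissibleWord_nil
  | append_singleton ω j ih =>
    rw [isAdmissibleWord_append_singleton] at hω
    rw [wordPerm_append_singleton] at hi
    have hi' := hω.2.almostFixes_of_mul hi
    rcases eq_or_ne j i with rfl | hj
    · rw [deleteLetter_append_self]
      exact ih hω.1 hi'
    · obtain ⟨j, rfl⟩ := exists_skip_eq hj
      obtain ⟨p, hp⟩ := hω.1.exists_isDeletion hi'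
      rw [deleteLetter_append_skip, isAdmissibleWord_append_singleton]
      exact ⟨ih hω.1 hi', hp.isAdmissibleStep hi hω.2⟩

theorem subwordSum_map_skip (hω : IsAdmissibleWord ω) (hi : AlmostFixes (wordPerm ω) i)
    (Φ : List ℕ → Prop) :
    subwordSum ω (fun w => ∃ w', w'.map (skip i) = w ∧ Φ w') =
      rename (skip i) (subwordSum (deleteLetter i ω) Φ) := by
  classical
  induction ω using List.reverseRecOn generalizing Φ with
  | nil =>
    have deleteLetter_nil : deleteLetter i [] = [] := rfl
    rw [deleteLetter_nil, subwordSum_nil, subwordSum_nil, apply_ite (rename (skip i)), map_one,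
      map_zero]
    simp only [List.map_eq_nil_iff, exists_eq_left]
  | append_singleton ω j ih =>
    rw [isAdmissibleWord_append_singleton] at hω
    rw [wordPerm_append_singleton] at hi
    have hi' := hω.2.almostFixes_of_mul hi
    rw [subwordSum_append_singleton, ih hω.1 hi']
    rcases eq_or_ne j i with rfl | hj
    · rw [deleteLetter_append_self, subwordSum_eq_zero ω, mul_zero, add_zero]
      exact fun w ⟨w', h, _⟩ => map_skip_ne_append_singleton j w w' h
    · obtain ⟨j, rfl⟩ := exists_skip_eq hj
      obtain ⟨p, hp⟩ := hω.1.exists_isDeletion hi'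
      obtain ⟨skip_j, skip_succ⟩ := hp.skip_pos hi
      simp only [exists_map_eq_append_singleton_iff (skip_injective i)]
      rw [deleteLetter_append_skip, subwordSum_append_singleton, ih hω.1 hi',
        map_add (rename (skip i)), map_mul, map_sub, rename_X, rename_X, ← hp.apply_skip,
        ← hp.apply_skip, skip_j, skip_succ]

end IsAdmissibleWord

/-! ### Evaluations -/

noncomputable section

theorem evPerm_xVar (σ : Equiv.Perm ℕ) (j : ℕ) : evPerm σ (xVar j) = X (σ j) := by
  simp [evPerm, xVar]

theorem evPerm_tVar (σ : Equiv.Perm ℕ) (j : ℕ) : evPerm σ (tVar j) = X j := by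
  simp [evPerm, tVar]

/-- `f ↦ f(t_{s(τ(0))}, t_{s(τ(1))}, …; t)`, where `s = skip i` is the increasing map that omits
`i`. -/
def evSkip (i : ℕ) (τ : Equiv.Perm ℕ) : PolTX →ₐ[ℤ] PolT :=
  aeval (Sum.elim (fun j => X (skip i (τ j))) X)

theorem evSkip_xVar (i : ℕ) (τ : Equiv.Perm ℕ) (j : ℕ) :
    evSkip i τ (xVar j) = X (skip i (τ j)) := by
  simp [evSkip, xVar]

theorem evSkip_tVar (i : ℕ) (τ : Equiv.Perm ℕ) (j : ℕ) : evSkip i τ (tVar j) = X j := by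
  simp [evSkip, tVar]

theorem evSkip_omitT (i : ℕ) (τ : Equiv.Perm ℕ) (f : PolTX) :
    evSkip i τ (omitT i f) = rename (skip i) (evPerm τ f) := by
  suffices (evSkip i τ).comp (omitT i) = (rename (skip i)).comp (evPerm τ) from
    DFunLike.congr_fun this f
  refine polTX_algHom_ext (fun j => ?_) fun j => ?_
  · simp only [AlgHom.comp_apply, omitT_xVar, evSkip_xVar, evPerm_xVar, rename_X]
  · simp only [AlgHom.comp_apply, omitT_tVar, evSkip_tVar, evPerm_tVar, rename_X]

namespace IsDeletion

variable {i p : ℕ} {τ σ : Equiv.Perm ℕ}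

theorem evPerm_eq (h : IsDeletion i p τ σ) (f : PolTX) :
    evPerm σ f = evSkip i τ (insertT p i f) := by
  suffices evPerm σ = (evSkip i τ).comp (insertT p i) from DFunLike.congr_fun this f
  refine polTX_algHom_ext (fun j => ?_) fun j => ?_
  · rw [AlgHom.comp_apply, evPerm_xVar]
    rcases eq_or_ne j p with rfl | hj
    · rw [insertT_xVar_self, evSkip_tVar, h.apply_pos]
    · obtain ⟨j, rfl⟩ := exists_skip_eq hj
      rw [insertT_xVar, if_neg hj, collapse_skip, evSkip_xVar, h.apply_skip]
  · simp only [AlgHom.comp_apply, insertT_tVar, evSkip_tVar, evPerm_tVar]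

/-- Exchanging the positions `i` and `i + 1` moves the value `t_i` between them, so the difference
of the two evaluations is a divided difference. -/
theorem evPerm_mul_simpleTransposition (h : IsDeletion i p τ σ) (f : PolTX) :
    evPerm (σ * simpleTransposition i) f =
      evPerm σ f + (X (σ (i + 1)) - X (σ i)) * evSkip i τ (eqTrim i f) := by
  have insertT_succ : evSkip i τ (insertT (i + 1) i f) = evSkip i τ (insertT i i f) +
      (X (skip i (τ i)) - X i) * evSkip i τ (eqTrim i f) := by
    rw [← evSkip_xVar, ← evSkip_tVar i τ, ← map_sub, ← map_mul, eqTrim_eq_trimAt, mul_trimAt,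
      ← map_add, add_sub_cancel]
  have apply_pos := h.apply_pos
  rw [h.mul_self.evPerm_eq, h.evPerm_eq]
  rcases h.pos with rfl | rfl
  · rw [simpleTransposition_left, insertT_succ, ← h.apply_skip, skip_of_le le_rfl, apply_pos]
  · rw [simpleTransposition_right, insertT_succ, ← h.apply_skip, skip_of_lt i.lt_succ_self,
      apply_pos]
    ring

end IsDeletion

theorem IsDoubleForestFamily.evPerm_eq_subwordSum {P : IndexedForest → PolTX}
    (hP : IsDoubleForestFamily P) {ω : List ℕ} (hω : IsAdmissibleWord ω) (F : IndexedForest) :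
    evPerm (wordPerm ω) (P F) = subwordSum ω F.IsSylvester := by
  classical
  induction hn : ω.length using Nat.strong_induction_on generalizing ω F with
  | _ n ih =>
    rcases ω.eq_nil_or_concat' with rfl | ⟨ω, i, rfl⟩
    · rw [subwordSum_nil]
      exact (hP.normalized F).trans (if_congr F.isSylvester_nil_iff.symm rfl rfl)
    rw [isAdmissibleWord_append_singleton] at hω
    have length_lt : ω.length < n := by simp [← hn]
    have almostFixes := hω.2.almostFixes
    obtain ⟨p, hp⟩ := hω.1.exists_isDeletion almostFixes
    rw [wordPerm_append_singleton, hp.evPerm_mul_simpleTransposition, subwordSum_append_singleton,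
      ih _ length_lt hω.1 F rfl, hP.trimming]
    congr 2
    by_cases hi : i ∈ F.qdes
    · rw [if_pos hi, evSkip_omitT, ih _ ((length_deleteLetter_le i ω).trans_lt length_lt)
        (hω.1.isAdmissibleWord_deleteLetter almostFixes) (F.trim i) rfl,
        ← hω.1.subwordSum_map_skip almostFixes]
      simp only [IndexedForest.isSylvester_append_singleton_iff hi]
    · rw [if_neg hi, map_zero, subwordSum_eq_zero]
      exact fun w hw => hi hw.mem_qdes

end

/-! ### Noncrossing reduced words are admissible -/

theorem backwardCycle_mem {B : Finset ℕ} {a : ℕ} (ha : a ∈ B) : backwardCycle B a ∈ B :=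
  (Finset.mem_sort _).mp (List.formPerm_apply_mem_of_mem ((Finset.mem_sort _).mpr ha))

theorem backwardCycle_succ {B : Finset ℕ} {a : ℕ} (ha : a ∈ B) (ha' : a + 1 ∈ B) :
    backwardCycle B (a + 1) = a := by
  have sorted := Finset.sortedGT_sort B
  obtain ⟨m, hm, getElem_m⟩ := List.getElem_of_mem ((Finset.mem_sort (· ≥ ·)).mpr ha)
  obtain ⟨k, hk, getElem_k⟩ := List.getElem_of_mem ((Finset.mem_sort (· ≥ ·)).mpr ha')
  have k_lt_m : k < m := sorted.getElem_lt_getElem_iff.mp (by omega)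
  have hk' : k + 1 < (B.sort (· ≥ ·)).length := by omega
  have lower : a ≤ (B.sort (· ≥ ·))[k + 1] :=
    getElem_m ▸ sorted.getElem_le_getElem_iff.mpr (by omega)
  have upper : (B.sort (· ≥ ·))[k + 1] < a + 1 :=
    getElem_k ▸ sorted.getElem_lt_getElem_iff.mpr k.lt_succ_self
  rw [backwardCycle, ← getElem_k, List.formPerm_apply_lt_getElem _ sorted.nodup _ hk']
  omega

namespace IsNoncrossingPerm

variable {n i : ℕ} {σ : Equiv.Perm ℕ}

/-- If `i` and `i + 1` lie in the same block, then `σ` maps `i + 1` to `i`; otherwise the chords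
from `i` and `i + 1` to their images do not cross. -/
theorem not_crossing (hσ : IsNoncrossingPerm n σ) (hi : i + 1 < n) (h : σ (i + 1) ≠ i) :
    σ i ≠ i + 1 ∧ ¬ (σ i < σ (i + 1) ∧ σ (i + 1) < i) ∧ ¬ (i + 1 < σ i ∧ σ i < σ (i + 1)) ∧
      ¬ (σ (i + 1) < i ∧ i + 1 < σ i) := by
  obtain ⟨-, P, hP, apply_eq⟩ := hσ
  obtain ⟨A, hA, hiA⟩ := P.exists_mem (Finset.mem_range.mpr (i.lt_succ_self.trans hi))
  obtain ⟨B, hB, hiB⟩ := P.exists_mem (Finset.mem_range.mpr hi)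
  have hσA : σ i ∈ A := apply_eq A hA i hiA ▸ backwardCycle_mem hiA
  have hσB : σ (i + 1) ∈ B := apply_eq B hB _ hiB ▸ backwardCycle_mem hiB
  have hAB : A ≠ B := by
    rintro rfl
    exact h (apply_eq A hA _ hiB ▸ backwardCycle_succ hiA hiB)
  refine ⟨fun e => hAB (P.eq_of_mem_parts hA hB (e ▸ hσA) hiB), fun hc => ?_, fun hc => ?_,
    fun hc => ?_⟩
  · exact hP A hA B hB hAB _ hσA _ hiA _ hσB _ hiB ⟨hc.1, hc.2, i.lt_succ_self⟩
  · exact hP A hA B hB hAB _ hiA _ hσA _ hiB _ hσB ⟨i.lt_succ_self, hc⟩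
  · exact hP B hB A hA hAB.symm _ hσB _ hiB _ hiA _ hσA ⟨hc.1, i.lt_succ_self, hc.2⟩

theorem isAdmissibleStep (hσ : IsNoncrossingPerm n σ) (hi : i + 1 < n)
    (hσ' : IsNoncrossingPerm n (σ * simpleTransposition i)) (hlt : σ i < σ (i + 1)) :
    IsAdmissibleStep σ i := by
  by_contra not_admissible
  rw [IsAdmissibleStep] at not_admissible
  have not_crossing := hσ.not_crossing hi (by omega)
  have not_crossing' := hσ'.not_crossing hi
  simp only [Equiv.Perm.mul_apply, simpleTransposition_left, simpleTransposition_right]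
    at not_crossing'
  have := not_crossing' (by omega)
  omega

end IsNoncrossingPerm

theorem lt_of_permLength_lt {n i : ℕ} {σ : Equiv.Perm ℕ} (hi : i + 1 < n)
    (h : permLength n σ < permLength n (σ * simpleTransposition i)) : σ i < σ (i + 1) := by
  contrapose! h
  refine Finset.card_le_card_of_injOn
    (Prod.map (simpleTransposition i) (simpleTransposition i)) ?_
    ((simpleTransposition i).injective.prodMap (simpleTransposition i).injective).injOn
  rintro ⟨a, b⟩ hab
  obtain ⟨hab_lt, a_lt_b, descent⟩ := Finset.mem_filter.mp hab
  rw [Finset.mem_product, Finset.mem_range, Finset.mem_range] at hab_lt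
  have ne_of_descent : ¬ (a = i ∧ b = i + 1) := by
    rintro ⟨rfl, rfl⟩
    rw [Equiv.Perm.mul_apply, Equiv.Perm.mul_apply, simpleTransposition_left,
      simpleTransposition_right] at descent
    omega
  refine Finset.mem_filter.mpr ⟨Finset.mem_product.mpr ?_, ?_, descent⟩ <;>
  · simp only [Prod.map_apply, Finset.mem_range, simpleTransposition, Equiv.swap_apply_def]
    split_ifs <;> omega

theorem IsNoncrossingReducedWord.isAdmissibleWord {n : ℕ} {σ : Equiv.Perm ℕ} {ω : List ℕ}
    (h : IsNoncrossingReducedWord n σ ω) : IsAdmissibleWord ω := by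
  rintro ω₁ j ⟨ω₂, rfl⟩
  have length_lt : ω₁.length < (ω₁ ++ [j] ++ ω₂).length := by simp
  have take_eq : (ω₁ ++ [j] ++ ω₂).take (ω₁.length + 1) = ω₁ ++ [j] :=
    List.take_left' List.length_append
  have get_eq : (ω₁ ++ [j] ++ ω₂).get ⟨ω₁.length, length_lt⟩ = j := by simp
  obtain ⟨noncrossing, hj, noncrossing', length_descent⟩ := h.2 ⟨ω₁.length, length_lt⟩
  simp only [take_eq, get_eq, wordPerm_append_singleton, mul_assoc, simpleTransposition_mul_self,
    mul_one] at noncrossing hj noncrossing' length_descent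
  exact noncrossing'.isAdmissibleStep hj noncrossing (lt_of_permLength_lt hj length_descent)

theorem theorem8p2_general (F : IndexedForest) {ω : List ℕ} (hω : IsAdmissibleWord ω) :
    evPerm (wordPerm ω) (doubleForestPoly F) =
      ∑ S ∈ sylvesterSubwords ω F, subwordWeight ω S := by
  rw [sum_sylvesterSubwords]
  exact isDoubleForestFamily_doubleForestPoly.evPerm_eq_subwordSum hω F

theorem theorem8p2 (n : ℕ) (F : IndexedForest) (hF : F.support ⊆ Set.Iio n)
    (σ : Equiv.Perm ℕ) (hσ : IsNoncrossingPerm n σ)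
    (ω : List ℕ) (hω : IsNoncrossingReducedWord n σ ω) :
    evPerm σ (doubleForestPoly F) = ∑ S ∈ sylvesterSubwords ω F, subwordWeight ω S := by
  rw [← hω.1]
  exact theorem8p2_general F hω.isAdmissibleWord
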